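/- **Setting.** Let $n\ge 2$, $d,s\ge 1$, $k\ge 0$ be integers with $d\mid n$ and $m:=d\,2^k\le n$, and let $0<\varepsilon\le 1$ with $k\varepsilon\le 1$. A *random sparse map* is $\varphi(u,v)=A_0u+A_1v$ on $\mathbb R^d\times\mathbb R^d\to\mathbb R^d$, where independently in every column of the $d\times d$ matrices $A_0,A_1$ one chooses uniformly at random $s$ distinct positions and fills them with independent uniform values from $\{-1/\sqrt s,\,1/\sqrt s\}$; the other entries are $0$. Let $\varphi_1,\dots,\varphi_k$ be independent random sparse maps. *SingleSketch*, for $y\in\mathbb R^m$: cut $y$ into consecutive blocks $v^{(0)}_1,\dots,v^{(0)}_{2^k}\in\mathbb R^d$; for $i=1,\dots,k$ and $1\le j\le 2^{k-i}$ put $v^{(i)}_j=\varphi_i(v^{(i-1)}_{2j-1},v^{(i-1)}_{2j})$; return $v^{(k)}_1$. *AllSketch*, for $x\in\mathbb R^n$ and the same maps: cut $x$ into consecutive blocks $v^{(0)}_1,\dots,v^{(0)}_{n/d}\in\mathbb R^d$; for $i=1,\dots,k$ and $1\le j\le n/d-2^i+1$ put $v^{(i)}_j=\varphi_i(v^{(i-1)}_{j},v^{(i-1)}_{j+2^{i-1}})$;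 return $v_j:=v^{(k)}_j$ for $1\le j\le t:=\frac{n-m}{d}+1$. Write $y_j=(x_{1+(j-1)d},\dots,x_{m+(j-1)d})\in\mathbb R^m$ for $1\le j\le t$. **Theorem.** There is an absolute constant $K>0$ such that for every $c>0$ there is $C_0>0$ such that for every $C_1$ there is $T>0$ with the following property. Let $n,d,k,s,\varepsilon$ be as above with $$C_0\frac{\log n}{\varepsilon^2}\le d\le C_1\frac{\log n}{\varepsilon^2},\qquad \varepsilon d\le s\le\min(d,\;C_1\varepsilon d),$$ and let $x\in\mathbb R^n$. Then: 1. With probability at least $1-n^{-c}$ over $\varphi_1,\dots,\varphi_k$, simultaneously for all $1\le j\le t$, $$(1-Kk\varepsilon)\|y_j\|\le\|v_j\|\le(1+Kk\varepsilon)\|y_j\|$$ (Euclidean norms). 2. For every choice of the maps $\varphi_i$, the map SingleSketch $:\mathbb R^m\to\mathbb R^d$ is linear, and $v_j$ is its value at $y_j$ for every $1\le j\le t$. 3. Given $x$ and the maps (stored by columns, as lists of the positions and values of the nonzero entries), AllSketch, written out as an explicit program for a random access machine with unit-cost operations on reals and indices, computes all $v_1,\dots,v_t$ in at most $T\,\frac{n\log^2n}{\varepsilon}$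 steps. -/

import Mathlib

open MeasureTheory ProbabilityTheory

noncomputable section

namespace Sketch

/-- `ℝ^d` with the Euclidean norm. -/
abbrev Vec (d : ℕ) := EuclideanSpace ℝ (Fin d)

/-! ### Random sparse maps `ℝ^d × ℝ^d → ℝ^d` -/

/-- The data of a sparse map `φ(u, v) = A₀ u + A₁ v`, stored by columns: column `c` of `A_b` has
exactly `s` nonzero entries, the `l`-th of which sits in row `pos b c l` and has sign `sgn b c l`
(and absolute value `1 / √s`). -/
structure SparseMap (d s : ℕ) where
  pos : Fin 2 → Fin d → (Fin s ↪ Fin d)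
  sgn : Fin 2 → Fin d → (Fin s → ℤˣ)

instance (d s : ℕ) : MeasurableSpace (SparseMap d s) := ⊤

/-- The distribution of sparse Johnson–Lindenstrauss maps: independently for every column, `s`
distinct positions are chosen uniformly at random and filled with independent uniform signs;
that is, the data are uniform on the finite type `SparseMap d s`. -/
def sparseJL (d s : ℕ) : Measure (SparseMap d s) := uniformOn Set.univ

namespace SparseMap

variable {d s : ℕ}

/-- The value `± 1 / √s` of a nonzero entry. -/
def val (φ : SparseMap d s) (b : Fin 2) (c : Fin d) (l : Fin s) : ℝ :=
  ((φ.sgn b c l : ℤ) : ℝ) / √(s : ℝ)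

/-- The matrices `A₀` and `A₁`. -/
def mat (φ : SparseMap d s) (b : Fin 2) : Matrix (Fin d) (Fin d) ℝ :=
  Matrix.of fun r c => ∑ l : Fin s, if φ.pos b c l = r then φ.val b c l else 0

/-- `φ(u, v) = A₀ u + A₁ v`. -/
def eval (φ : SparseMap d s) (u v : Vec d) : Vec d :=
  WithLp.toLp 2 ((φ.mat 0).mulVec u.ofLp + (φ.mat 1).mulVec v.ofLp)

end SparseMap

/-! ### The two procedures

Words, blocks and levels are indexed from `0`. An index outside the input reads `0`; the outputs
defined below never depend on such an entry, when they have the indices that the procedures use. -/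

/-- The subword of length `m` of `x` that starts at position `p`. -/
def subword {n : ℕ} (x : Vec n) (m p : ℕ) : Vec m :=
  WithLp.toLp 2 fun r => if h : p + r.1 < n then x ⟨p + r.1, h⟩ else 0

/-- The `j`-th block of length `d` of `x`. -/
def block {n : ℕ} (d : ℕ) (x : Vec n) (j : ℕ) : Vec d := subword x d (j * d)

/-- The vectors of level `i` of `SingleSketch`: level `i + 1` arises from level `i` by
compressing the pairs of vectors number `2 j` and `2 j + 1`. -/
def singleLevel {d s k : ℕ} (φ : Fin k → SparseMap d s) (v₀ : ℕ → Vec d) :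
    (i : ℕ) → i ≤ k → ℕ → Vec d
  | 0, _ => v₀
  | i + 1, h => fun j =>
      (φ ⟨i, h⟩).eval (singleLevel φ v₀ i (Nat.le_of_succ_le h) (2 * j))
        (singleLevel φ v₀ i (Nat.le_of_succ_le h) (2 * j + 1))

/-- Procedure `SingleSketch`, for an input of length `m = d * 2 ^ k`. -/
def singleSketch {d s k : ℕ} (φ : Fin k → SparseMap d s) (y : Vec (d * 2 ^ k)) : Vec d :=
  singleLevel φ (block d y) k le_rfl 0

/-- The vectors of level `i` of `AllSketch`: level `i + 1` arises from level `i` by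
compressing the pairs of vectors number `j` and `j + 2 ^ i`. -/
def allLevel {d s k : ℕ} (φ : Fin k → SparseMap d s) (v₀ : ℕ → Vec d) :
    (i : ℕ) → i ≤ k → ℕ → Vec d
  | 0, _ => v₀
  | i + 1, h => fun j =>
      (φ ⟨i, h⟩).eval (allLevel φ v₀ i (Nat.le_of_succ_le h) j)
        (allLevel φ v₀ i (Nat.le_of_succ_le h) (j + 2 ^ i))

/-- Output number `j` of procedure `AllSketch`. -/
def allSketch {n d s k : ℕ} (φ : Fin k → SparseMap d s) (x : Vec n) (j : ℕ) : Vec d :=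
  allLevel φ (block d x) k le_rfl j

/-! ### A random access machine with step count -/

/-- Memory: registers and arrays of natural numbers, and arrays of real numbers. -/
structure State where
  reg : ℕ → ℕ
  natArr : ℕ → ℕ → ℕ
  realArr : ℕ → ℕ → ℝ

/-- Index expressions; `get a e` reads cell `e` of the array `a`. -/
inductive NExp where
  | const (c : ℕ)
  | reg (r : ℕ)
  | get (a : ℕ) (e : NExp)
  | add (e f : NExp)
  | sub (e f : NExp)
  | mul (e f : NExp)
  | div (e f : NExp)

/-- Real expressions. -/
inductive RExp where
  | zero
  | get (a : ℕ) (e : NExp)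
  | add (e f : RExp)
  | mul (e f : RExp)

/-- Programs. `setReg r e` stores `e` in a register, `setReal a i e` stores `e` in cell `i` of
the real array `a`, and `loop r e c` runs `c` for `r = 0, …, e - 1`, where the bound `e` is
evaluated once, at the start. -/
inductive Cmd where
  | setReg (r : ℕ) (e : NExp)
  | setReal (a : ℕ) (i : NExp) (e : RExp)
  | seq (c₁ c₂ : Cmd)
  | loop (r : ℕ) (e : NExp) (c : Cmd)

namespace NExp

def eval (σ : State) : NExp → ℕ
  | const c => c
  | reg r => σ.reg r
  | get a e => σ.natArr a (e.eval σ)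
  | add e f => e.eval σ + f.eval σ
  | sub e f => e.eval σ - f.eval σ
  | mul e f => e.eval σ * f.eval σ
  | div e f => e.eval σ / f.eval σ

/-- One step for every constant, memory access and arithmetic operation. -/
def cost : NExp → ℕ
  | const _ => 1
  | reg _ => 1
  | get _ e => e.cost + 1
  | add e f => e.cost + f.cost + 1
  | sub e f => e.cost + f.cost + 1
  | mul e f => e.cost + f.cost + 1
  | div e f => e.cost + f.cost + 1

end NExp

namespace RExp

def eval (σ : State) : RExp → ℝ
  | zero => 0
  | get a e => σ.realArr a (e.eval σ)
  | add e f => e.eval σ + f.eval σ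
  | mul e f => e.eval σ * f.eval σ

/-- One step for every constant, memory access and arithmetic operation. -/
def cost : RExp → ℕ
  | zero => 1
  | get _ e => e.cost + 1
  | add e f => e.cost + f.cost + 1
  | mul e f => e.cost + f.cost + 1

end RExp

namespace State

def setReg (σ : State) (r v : ℕ) : State :=
  { σ with reg := Function.update σ.reg r v }

def setReal (σ : State) (a i : ℕ) (v : ℝ) : State :=
  { σ with realArr := Function.update σ.realArr a (Function.update (σ.realArr a) i v) }

end State

/-- Run `f 0, …, f (b - 1)` one after another, adding up the steps, with one more step for every
iteration. -/
def iter (f : ℕ → State → State × ℕ) : ℕ → State → State × ℕ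
  | 0, σ => (σ, 0)
  | b + 1, σ =>
      let p := iter f b σ
      let q := f b p.1
      (q.1, p.2 + q.2 + 1)

/-- The final state and the number of steps. -/
def Cmd.exec : Cmd → State → State × ℕ
  | setReg r e, σ => (σ.setReg r (e.eval σ), e.cost + 1)
  | setReal a i e, σ => (σ.setReal a (i.eval σ) (e.eval σ), i.cost + e.cost + 1)
  | seq c₁ c₂, σ =>
      let p := c₁.exec σ
      let q := c₂.exec p.1
      (q.1, p.2 + q.2)
  | loop r e c, σ =>
      let p := iter (fun t τ => c.exec (τ.setReg r t)) (e.eval σ) σ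
      (p.1, p.2 + e.cost + 1)

/-! ### `AllSketch` as a program

Registers: `0`–`3` hold the inputs `n`, `d`, `k`, `s`; `4`–`7` are the loop variables `i`, `j`,
`c`, `l`; `8` holds the power `2 ^ i`.
Natural array: `0` holds the positions of the nonzero entries of the maps.
Real arrays: `0` holds the input word, `1` the values of the nonzero entries, `2` the vectors of
all levels (coordinate `r` of vector `j` of level `i` in cell `i * n + (j * d + r)`), `3` the
output (coordinate `r` of vector `j` in cell `j * d + r`). -/

/-- The cell with the data of the `l`-th nonzero entry in column `c` of the matrix `A_b` of the
`i`-th map. -/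
def entryCell (d s i b c l : ℕ) : ℕ := ((2 * i + b) * d + c) * s + l

/-- `σ` holds the sizes, the maps `φ` and the word `x` in the registers and arrays above. -/
structure IsInput {n d s k : ℕ} (φ : Fin k → SparseMap d s) (x : Vec n) (σ : State) : Prop where
  reg_n : σ.reg 0 = n
  reg_d : σ.reg 1 = d
  reg_k : σ.reg 2 = k
  reg_s : σ.reg 3 = s
  word : ∀ q : Fin n, σ.realArr 0 q = x q
  pos : ∀ (i : Fin k) (b : Fin 2) (c : Fin d) (l : Fin s),
    σ.natArr 0 (entryCell d s i b c l) = (φ i).pos b c l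
  val : ∀ (i : Fin k) (b : Fin 2) (c : Fin d) (l : Fin s),
    σ.realArr 1 (entryCell d s i b c l) = (φ i).val b c l

namespace Prog

def n : NExp := .reg 0
def d : NExp := .reg 1
def k : NExp := .reg 2
def s : NExp := .reg 3
def i : NExp := .reg 4
def j : NExp := .reg 5
def c : NExp := .reg 6
def l : NExp := .reg 7
def pw : NExp := .reg 8

/-- The cell `i * n + (j * d + r)`. -/
def cell (i j r : NExp) : NExp := .add (.mul i n) (.add (.mul j d) r)

/-- The cell `((2 * i + b) * d + c) * s + l`. -/
def entry (b : ℕ) : NExp :=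
  .add (.mul (.add (.mul (.add (.mul (.const 2) i) (.const b)) d) c) s) l

/-- Let the `l`-th nonzero entry of column `c` of `A_b` sit in row `p`. Add `A_b[p, c] * u[c]` to
coordinate `p` of vector `j` of level `i + 1`, where `u` is vector `src` of level `i`. -/
def accumulate (b : ℕ) (src : NExp) : Cmd :=
  let target := cell (.add i (.const 1)) j (.get 0 (entry b))
  .setReal 2 target (.add (.get 2 target) (.mul (.get 1 (entry b)) (.get 2 (cell i src c))))

/-- Vector `j` of level `i + 1` becomes `φ(u, v)` for the vectors `u`, `v` number `j` and
`j + 2 ^ i` of level `i`. -/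
def applyMap : Cmd :=
  .seq (.loop 6 d (.setReal 2 (cell (.add i (.const 1)) j c) .zero))
    (.loop 6 d (.loop 7 s (.seq (accumulate 0 j) (accumulate 1 (.add j pw)))))

/-- The number `n / d - pw + 1`. -/
def count (pw : NExp) : NExp := .sub (.add (.div n d) (.const 1)) pw

/-- Procedure `AllSketch`: copy the blocks of the input to level `0`, compute the levels
`1, …, k`, and copy level `k` to the output. -/
def allSketch : Cmd :=
  .seq (.loop 6 n (.setReal 2 c (.get 0 c))) <|
  .seq (.setReg 8 (.const 1)) <|
  .seq (.loop 4 k <|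
    .seq (.loop 5 (count (.add pw pw)) applyMap) (.setReg 8 (.add pw pw))) <|
  .loop 5 (count pw) (.loop 6 d (.setReal 3 (.add (.mul j d) c) (.get 2 (cell k j c))))

end Prog

end Sketch

end

namespace Sketch

open Finset

/-! ### Two moment generating functions -/

/-! Everything rests on a Chernoff bound for one sparse map. By homogeneity let ‖u‖² + ‖v‖² = 1. For
fixed positions, ‖φ(u, v)‖² - 1 is a Rademacher chaos of order two that splits over the rows.
Integrating out the signs one at a time with cosh g ≤ exp(g² / 2) preserves this shape
(`sum_exp_chaos_le`) and leaves in the exponent a weighted mean of the overlaps of pairs of columns.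
Convexity of exp reduces to a single overlap, the number of hits of a fixed s-set by a random one,
which is dominated by sampling with replacement (`sum_embedding_prod_le`). The result is E
exp(t(‖φ(u, v)‖² - 1)) ≤ exp(8t²/d) for |t| ≤ s/8 (`SparseMap.sum_exp_le`). The choice t = ±εd/16,
admissible because εd ≤ s, shows that the relative error exceeds ε with probability at most 2
exp(-ε²d/32) (`SparseMap.card_bad_le`). All distributions are uniform on finite types, so
expectations are written as sums.

The pair compressed by a map depends only on the maps of earlier levels, so the bound holds
conditionally on those, and a union bound covers all levels and positions. If no pair is distorted,
squared norms change by a factor between (1-ε)^k and (1+ε)^k, and kε ≤ 1 turns this into 1 ± 2kε for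
norms.

Vector j of level i in AllSketch depends only on the blocks j, …, j + 2^i - 1 and so is shared by
all subwords that use these blocks in this role (`singleLevel_eq_allLevel`). Hence each level needs
at most n/d applications of a map, each of O(ds) steps, which makes O((k+1)ns) in total; here k + 1
= O(log n) and s = O(log n / ε). Correctness of the program is proved with loop invariants. -/

theorem sum_exp_add_sign_mul_le {I : Type*} [Fintype I] [DecidableEq I] (i : I)
    (f g : (I → ℤˣ) → ℝ)
    (hf : ∀ σ, f (Function.update σ i (-σ i)) = f σ)
    (hg : ∀ σ, g (Function.update σ i (-σ i)) = g σ) :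
    ∑ σ : I → ℤˣ, Real.exp (f σ + ((σ i : ℤ) : ℝ) * g σ) ≤
      ∑ σ : I → ℤˣ, Real.exp (f σ + g σ ^ 2 / 2) := by
  -- Flipping the sign `i` preserves the uniform distribution, so averaging over the flip replaces
  -- exp(± g) by cosh g ≤ exp(g² / 2).
  have hflip : Function.Involutive (fun σ : I → ℤˣ => Function.update σ i (-σ i)) := by
    intro σ
    simp
  have h := Equiv.sum_comp hflip.toPerm
    (fun σ : I → ℤˣ => Real.exp (f σ + ((σ i : ℤ) : ℝ) * g σ))
  simp only [Function.Involutive.coe_toPerm, hf, hg, Function.update_self, Units.val_neg,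
    Int.cast_neg] at h
  have h2 : 2 * ∑ σ : I → ℤˣ, Real.exp (f σ + ((σ i : ℤ) : ℝ) * g σ) ≤
      2 * ∑ σ : I → ℤˣ, Real.exp (f σ + g σ ^ 2 / 2) := by
    rw [two_mul]
    nth_rewrite 1 [← h]
    rw [← sum_add_distrib, mul_sum]
    refine sum_le_sum fun σ _ => ?_
    have hc := Real.cosh_le_exp_half_sq (g σ)
    rw [Real.cosh_eq] at hc
    have he := Real.exp_pos (f σ)
    simp only [Real.exp_add]
    rcases Int.units_eq_one_or (σ i) with h1 | h1 <;> rw [h1] <;> simp <;> nlinarith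
  linarith

/-- The second order Rademacher chaos `∑ r, μ r * ((∑ i in row r, a i σ i) ^ 2 - ∑ a i ^ 2)`. -/
theorem sum_exp_chaos_le {I R : Type*} [Fintype I] [DecidableEq I] [Fintype R] [DecidableEq R]
    (ρ : I → R) (a : I → ℝ) (B : ℝ) (T : Finset I) : ∀ μ : R → ℝ,
    (∀ r, |μ r| + 2 * B ^ 2 * (∑ i ∈ T, if ρ i = r then a i ^ 2 else 0) ≤ B) →
    ∑ σ : I → ℤˣ, Real.exp (∑ r, μ r *
        ((∑ i ∈ T, if ρ i = r then a i * ((σ i : ℤ) : ℝ) else 0) ^ 2 -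
          ∑ i ∈ T, if ρ i = r then a i ^ 2 else 0)) ≤
      Fintype.card (I → ℤˣ) * Real.exp (B ^ 2 *
        ((∑ r, (∑ i ∈ T, if ρ i = r then a i ^ 2 else 0) ^ 2) - ∑ i ∈ T, a i ^ 4)) := by
  -- Removing a sign raises the coefficient of its row, so `μ` has to vary with the row and be
  -- general in the induction. The hypothesis reserves room for all the increases still to come.
  induction T using Finset.induction_on with
  | empty => intro μ _; simp
  | insert p T hp ih =>
    intro μ hμ
    set q : R → ℝ := fun r => ∑ i ∈ T, if ρ i = r then a i ^ 2 else 0 with hq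
    set S : (I → ℤˣ) → R → ℝ :=
      fun σ r => ∑ i ∈ T, if ρ i = r then a i * ((σ i : ℤ) : ℝ) else 0 with hS
    have hq0 : ∀ r, 0 ≤ q r := fun r => sum_nonneg fun i _ => by split_ifs <;> positivity
    simp only [sum_insert hp] at hμ ⊢
    have hμ0 := hμ (ρ p)
    simp only [if_true] at hμ0
    set m := μ (ρ p) with hm
    have hmB : m ^ 2 ≤ B ^ 2 := by
      rw [← sq_abs m]
      have : 0 ≤ 2 * B ^ 2 * (a p ^ 2 + q (ρ p)) := by have := hq0 (ρ p); positivity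
      have h2 : |m| ≤ B := by linarith [this, hμ0]
      exact pow_le_pow_left₀ (abs_nonneg _) h2 2
    have hSflip : ∀ σ : I → ℤˣ, S (Function.update σ p (-σ p)) = S σ := by
      intro σ
      funext r
      refine sum_congr rfl fun i hi => ?_
      have : i ≠ p := fun h => hp (h ▸ hi)
      rw [Function.update_of_ne this]
    -- Since `σ p` squares to 1, the square of the new term cancels and only the cross term is left.
    have hexp : ∀ σ : I → ℤˣ, (∑ r, μ r *
        (((if ρ p = r then a p * ((σ p : ℤ) : ℝ) else 0) + S σ r) ^ 2 -
          ((if ρ p = r then a p ^ 2 else 0) + q r))) =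
        (∑ r, μ r * (S σ r ^ 2 - q r)) + ((σ p : ℤ) : ℝ) * (2 * m * a p * S σ (ρ p)) := by
      intro σ
      have hs : (((σ p : ℤ) : ℝ)) ^ 2 = 1 := by
        rcases Int.units_eq_one_or (σ p) with h1 | h1 <;> rw [h1] <;> simp
      have : ((σ p : ℤ) : ℝ) * (2 * m * a p * S σ (ρ p)) =
          ∑ r, if ρ p = r then ((σ p : ℤ) : ℝ) * (2 * μ r * a p * S σ r) else 0 := by simp [hm]
      rw [this, ← sum_add_distrib]
      refine sum_congr rfl fun r _ => ?_
      split_ifs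
      · linear_combination μ r * a p ^ 2 * hs
      · ring
    -- The squared cross term involves only the row of `p`. Its centred part is absorbed into the
    -- coefficient of that row; its mean leaves the chaos as a constant.
    have hstep : ∀ σ : I → ℤˣ, (∑ r, μ r * (S σ r ^ 2 - q r)) +
        (2 * m * a p * S σ (ρ p)) ^ 2 / 2 =
        (∑ r, Function.update μ (ρ p) (m + 2 * m ^ 2 * a p ^ 2) r * (S σ r ^ 2 - q r)) +
          2 * m ^ 2 * a p ^ 2 * q (ρ p) := by
      intro σ
      have : ∀ r, Function.update μ (ρ p) (m + 2 * m ^ 2 * a p ^ 2) r * (S σ r ^ 2 - q r) =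
          μ r * (S σ r ^ 2 - q r) +
            if ρ p = r then 2 * m ^ 2 * a p ^ 2 * (S σ r ^ 2 - q r) else 0 := by
        intro r
        by_cases h : ρ p = r
        · subst h; simp [hm]; ring
        · simp [h, Function.update_of_ne (Ne.symm h)]
      simp only [this, sum_add_distrib, sum_ite_eq, mem_univ, if_true]
      ring
    -- The part a_p^4 is cancelled by the subtracted fourth powers; the rest is exactly the constant
    -- that left the chaos, up to the factor B².
    have hnew : ∑ r, ((if ρ p = r then a p ^ 2 else 0) + q r) ^ 2 =
        (∑ r, q r ^ 2) + (2 * a p ^ 2 * q (ρ p) + a p ^ 4) := by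
      have : ∀ r, ((if ρ p = r then a p ^ 2 else 0) + q r) ^ 2 =
          q r ^ 2 + if ρ p = r then 2 * a p ^ 2 * q r + a p ^ 4 else 0 := by
        intro r
        split_ifs <;> ring
      simp only [this, sum_add_distrib, sum_ite_eq, mem_univ, if_true]
    have key := ih (Function.update μ (ρ p) (m + 2 * m ^ 2 * a p ^ 2)) (by
      intro r
      by_cases h : ρ p = r
      · subst h
        rw [Function.update_self]
        have h1 : |m + 2 * m ^ 2 * a p ^ 2| ≤ |m| + 2 * B ^ 2 * a p ^ 2 := by
          refine (abs_add_le _ _).trans ?_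
          rw [abs_of_nonneg (by positivity : 0 ≤ 2 * m ^ 2 * a p ^ 2)]
          nlinarith [sq_nonneg (a p)]
        change _ + 2 * B ^ 2 * q (ρ p) ≤ B
        change _ + 2 * B ^ 2 * (_ + q (ρ p)) ≤ B at hμ0
        linarith
      · rw [Function.update_of_ne (Ne.symm h)]
        have := hμ r
        simpa [h] using this)
    calc ∑ σ : I → ℤˣ, Real.exp (∑ r, μ r *
          (((if ρ p = r then a p * ((σ p : ℤ) : ℝ) else 0) + S σ r) ^ 2 -
            ((if ρ p = r then a p ^ 2 else 0) + q r)))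
        = ∑ σ : I → ℤˣ, Real.exp ((∑ r, μ r * (S σ r ^ 2 - q r)) +
            ((σ p : ℤ) : ℝ) * (2 * m * a p * S σ (ρ p))) := by simp only [hexp]
      _ ≤ ∑ σ : I → ℤˣ, Real.exp ((∑ r, μ r * (S σ r ^ 2 - q r)) +
            (2 * m * a p * S σ (ρ p)) ^ 2 / 2) :=
          sum_exp_add_sign_mul_le p (fun σ => ∑ r, μ r * (S σ r ^ 2 - q r))
            (fun σ => 2 * m * a p * S σ (ρ p)) (fun σ => by simp only [hSflip])
            (fun σ => by simp only [hSflip])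
      _ = (∑ σ : I → ℤˣ, Real.exp (∑ r, Function.update μ (ρ p) (m + 2 * m ^ 2 * a p ^ 2) r *
            (S σ r ^ 2 - q r))) * Real.exp (2 * m ^ 2 * a p ^ 2 * q (ρ p)) := by
          simp only [hstep, Real.exp_add, sum_mul]
      _ ≤ (Fintype.card (I → ℤˣ) * Real.exp (B ^ 2 * ((∑ r, q r ^ 2) - ∑ i ∈ T, a i ^ 4))) *
            Real.exp (2 * B ^ 2 * a p ^ 2 * q (ρ p)) := by
          refine mul_le_mul key (Real.exp_le_exp.2 ?_) (Real.exp_pos _).le (by positivity)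
          have := hq0 (ρ p)
          gcongr
      _ = _ := by
          rw [hnew, mul_assoc, ← Real.exp_add]
          congr 2
          ring

/-- The moment generating function of the number of hits of a set under sampling without
replacement is at most the one under sampling with replacement. -/
theorem sum_embedding_prod_le {ι α : Type*} [Fintype ι] [Fintype α] [DecidableEq ι]
    [DecidableEq α] [Nonempty α] (A : Finset α) {θ : ℝ} (hθ : 0 ≤ θ) (T : Finset ι) :
    ∑ f : ι ↪ α, ∏ l ∈ T, (1 + θ * if f l ∈ A then 1 else 0) ≤
      Fintype.card (ι ↪ α) * (1 + (#A : ℝ) / Fintype.card α * θ) ^ #T := by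
  induction T using Finset.induction_on with
  | empty => simp
  | insert p T hp ih =>
    set W : (ι ↪ α) → ℝ := fun f => ∏ l ∈ T, (1 + θ * if f l ∈ A then 1 else 0) with hW
    have hW0 : ∀ f, 0 ≤ W f := fun f => prod_nonneg fun l _ => by split_ifs <;> positivity
    set N : α → ℝ := fun x => ∑ f : ι ↪ α, if f p = x then W f else 0 with hN
    -- Swapping the values x and y turns samples with `f p = x` into samples with `f p = y`. No
    -- other draw equals x, by injectivity, so the swap can only create hits among the other draws.
    have hle : ∀ x ∈ A, ∀ y ∉ A, N x ≤ N y := by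
      intro x hx y hy
      let e : (ι ↪ α) ≃ (ι ↪ α) := (Equiv.refl ι).embeddingCongr (Equiv.swap x y)
      have he : ∀ f l, e f l = Equiv.swap x y (f l) := fun f l => rfl
      simp only [hN]
      rw [← Equiv.sum_comp e (fun f => if f p = y then W f else 0)]
      refine sum_le_sum fun f _ => ?_
      by_cases hf : f p = x
      · rw [if_pos hf, if_pos (by rw [he, hf, Equiv.swap_apply_left])]
        refine prod_le_prod (fun l _ => by split_ifs <;> positivity) fun l hl => ?_
        have hlp : f l ≠ x := fun h => hp (f.injective (h.trans hf.symm) ▸ hl)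
        rw [he]
        by_cases hly : f l = y
        · rw [hly, Equiv.swap_apply_right, if_pos hx, if_neg hy]
          linarith
        · rw [Equiv.swap_apply_of_ne_of_ne hlp hly]
      · rw [if_neg hf]
        split_ifs
        · exact hW0 _
        · exact le_rfl
    have htot : ∑ x, N x = ∑ f, W f := by
      simp only [hN]
      rw [sum_comm]
      simp
    have hA : ∑ x ∈ A, N x = ∑ f : ι ↪ α, W f * if f p ∈ A then 1 else 0 := by
      simp only [hN]
      rw [sum_comm]
      refine sum_congr rfl fun f _ => ?_
      simp
    -- Summed over all x and y, this compares averages: the weighted share of samples with `f p ∈ A`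
    -- is at most #A / card α.
    have hcmp : (#Aᶜ : ℝ) * ∑ x ∈ A, N x ≤ #A * ∑ y ∈ Aᶜ, N y := by
      have h1 : ∑ x ∈ A, ∑ _y ∈ Aᶜ, N x ≤ ∑ _x ∈ A, ∑ y ∈ Aᶜ, N y :=
        sum_le_sum fun x hx => sum_le_sum fun y hy => hle x hx y (mem_compl.1 hy)
      simpa [mul_sum] using h1
    have hcard : (#Aᶜ : ℝ) + #A = Fintype.card α := by
      rw [← card_compl_add_card A]; push_cast; ring
    have hsplit := sum_add_sum_compl A N
    have hpos : (0 : ℝ) < Fintype.card α := by exact_mod_cast Fintype.card_pos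
    have hfrac : ∑ x ∈ A, N x ≤ (#A : ℝ) / Fintype.card α * ∑ f, W f := by
      rw [div_mul_eq_mul_div, le_div_iff₀ hpos, ← htot, ← hsplit, ← hcard]
      linarith
    rw [card_insert_of_notMem hp, pow_succ, ← mul_assoc]
    calc ∑ f : ι ↪ α, ∏ l ∈ insert p T, (1 + θ * if f l ∈ A then 1 else 0)
        = (∑ f, W f) + θ * ∑ x ∈ A, N x := by
          rw [hA, mul_sum, ← sum_add_distrib]
          refine sum_congr rfl fun f _ => ?_
          rw [prod_insert hp]
          simp only [hW]
          ring
      _ ≤ (∑ f, W f) + θ * ((#A : ℝ) / Fintype.card α * ∑ f, W f) := by gcongr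
      _ = (∑ f, W f) * (1 + (#A : ℝ) / Fintype.card α * θ) := by ring
      _ ≤ _ := by gcongr

theorem exp_mul_card_le_prod {ι : Type*} [Fintype ι] (P : ι → Prop) [DecidablePred P] {t : ℝ}
    (ht0 : 0 ≤ t) (ht1 : t ≤ 1) :
    Real.exp (t * ∑ l, if P l then (1 : ℝ) else 0) ≤
      ∏ l, (1 + 2 * t * if P l then (1 : ℝ) else 0) := by
  rw [mul_sum, Real.exp_sum]
  refine prod_le_prod (fun l _ => (Real.exp_pos _).le) fun l _ => ?_
  split_ifs
  · have := Real.abs_exp_sub_one_le (x := t) (by rwa [abs_of_nonneg ht0])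
    rw [abs_of_nonneg ht0] at this
    have := (abs_le.1 this).2
    simp only [mul_one]
    linarith
  · simp

theorem sum_embedding_exp_le {s d : ℕ} (hd : 0 < d) (A : Finset (Fin d)) {t : ℝ}
    (ht0 : 0 ≤ t) (ht1 : t ≤ 1) :
    ∑ f : Fin s ↪ Fin d, Real.exp (t * ∑ l, if f l ∈ A then (1 : ℝ) else 0) ≤
      Fintype.card (Fin s ↪ Fin d) * Real.exp (2 * t * (#A * s / d)) := by
  have : Nonempty (Fin d) := ⟨⟨0, hd⟩⟩
  calc _ ≤ ∑ f : Fin s ↪ Fin d, ∏ l, (1 + 2 * t * if f l ∈ A then (1 : ℝ) else 0) :=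
        sum_le_sum fun f _ => exp_mul_card_le_prod (fun l => f l ∈ A) ht0 ht1
    _ ≤ _ := sum_embedding_prod_le A (by positivity) univ
    _ ≤ Fintype.card (Fin s ↪ Fin d) *
          Real.exp ((#A : ℝ) / Fintype.card (Fin d) * (2 * t)) ^ #(univ : Finset (Fin s)) := by
        gcongr
        have := Real.add_one_le_exp ((#A : ℝ) / Fintype.card (Fin d) * (2 * t))
        linarith
    _ = _ := by
        rw [← Real.exp_nat_mul]
        simp only [Fintype.card_fin, card_univ]
        congr 2
        ring

/-- Resampling one coordinate: exchanging the old value with the new one is an involution. This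
plays the role of conditioning on all other coordinates, both for columns and for maps. -/
theorem card_mul_sum_eq_sum_sum_update {I : Type*} [Fintype I] [DecidableEq I] {α : I → Type*}
    [∀ i, Fintype (α i)] (i : I) (F : (∀ i, α i) → ℝ) :
    (Fintype.card (α i) : ℝ) * ∑ x, F x = ∑ x, ∑ a, F (Function.update x i a) := by
  have hinv : Function.Involutive
      (fun p : (∀ i, α i) × α i => (Function.update p.1 i p.2, p.1 i)) := by
    rintro ⟨x, a⟩
    simp
  have h := Equiv.sum_comp hinv.toPerm (fun p : (∀ i, α i) × α i => F p.1)
  rw [Fintype.sum_prod_type, Fintype.sum_prod_type] at h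
  simp only [Function.Involutive.coe_toPerm, sum_const, nsmul_eq_mul, card_univ] at h
  rw [h, mul_sum]

/-! ### The moment generating function of one sparse map -/

/-- Positions and signs are separated so that the signs can be summed first, for fixed positions. -/
def SparseMap.equivProd (d s : ℕ) : SparseMap d s ≃
    (Fin 2 × Fin d → (Fin s ↪ Fin d)) × ((Fin 2 × Fin d) × Fin s → ℤˣ) where
  toFun φ := (fun j => φ.pos j.1 j.2, fun i => φ.sgn i.1.1 i.1.2 i.2)
  invFun p := ⟨fun b c => p.1 (b, c), fun b c l => p.2 ((b, c), l)⟩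
  left_inv _ := rfl
  right_inv _ := rfl

noncomputable instance (d s : ℕ) : Fintype (SparseMap d s) :=
  Fintype.ofEquiv _ (SparseMap.equivProd d s).symm

instance (d s : ℕ) : DiscreteMeasurableSpace (SparseMap d s) := ⟨fun _ => trivial⟩

theorem SparseMap.nonempty {d s : ℕ} (h : s ≤ d) : Nonempty (SparseMap d s) :=
  ⟨⟨fun _ _ => Fin.castLEEmb h, fun _ _ _ => 1⟩⟩

/-- The coordinates of a pair of vectors. -/
def pairCoord {d : ℕ} (u v : Vec d) (j : Fin 2 × Fin d) : ℝ := if j.1 = 0 then u j.2 else v j.2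

theorem sum_pairCoord_sq {d : ℕ} (u v : Vec d) :
    ∑ j, pairCoord u v j ^ 2 = ‖u‖ ^ 2 + ‖v‖ ^ 2 := by
  simp [Fintype.sum_prod_type, pairCoord, EuclideanSpace.norm_sq_eq, Fin.sum_univ_two]

/-- The sum of the entries `z j * σ (j, l)` that are placed in row `r`. -/
def rowSum {d s : ℕ} {J : Type*} [Fintype J] (P : J → (Fin s ↪ Fin d)) (y : J × Fin s → ℝ)
    (r : Fin d) : ℝ :=
  ∑ i : J × Fin s, if P i.1 i.2 = r then y i else 0

theorem SparseMap.eval_apply {d s : ℕ} (φ : SparseMap d s) (u v : Vec d) (r : Fin d) :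
    φ.eval u v r = rowSum (equivProd d s φ).1
      (fun i => pairCoord u v i.1 * (((equivProd d s φ).2 i : ℤ) : ℝ)) r / √(s : ℝ) := by
  simp only [eval, rowSum, Fintype.sum_prod_type, Fin.sum_univ_two, pairCoord, equivProd,
    Equiv.coe_fn_mk, Pi.add_apply, Matrix.mulVec, dotProduct, mat, Matrix.of_apply, val, sum_mul,
    add_div, sum_div]
  congr 1 <;>
  · refine sum_congr rfl fun c _ => sum_congr rfl fun l _ => ?_
    split_ifs <;> first | contradiction | ring

theorem sum_rowSum {d s : ℕ} {J : Type*} [Fintype J] (P : J → (Fin s ↪ Fin d))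
    (y : J × Fin s → ℝ) : ∑ r, rowSum P y r = ∑ i, y i := by
  simp only [rowSum]
  rw [sum_comm]
  simp

theorem SparseMap.norm_eval_sq {d s : ℕ} (hs : 0 < s) (φ : SparseMap d s) (u v : Vec d) :
    ‖φ.eval u v‖ ^ 2 - (‖u‖ ^ 2 + ‖v‖ ^ 2) = ∑ r, (1 / (s : ℝ)) *
      (rowSum (equivProd d s φ).1
        (fun i => pairCoord u v i.1 * (((equivProd d s φ).2 i : ℤ) : ℝ)) r ^ 2 -
        rowSum (equivProd d s φ).1 (fun i => pairCoord u v i.1 ^ 2) r) := by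
  have hs' : (0 : ℝ) < s := by exact_mod_cast hs
  rw [← mul_sum, sum_sub_distrib, sum_rowSum, ← sum_pairCoord_sq, EuclideanSpace.norm_sq_eq]
  simp only [SparseMap.eval_apply, Real.norm_eq_abs, sq_abs, div_pow, Real.sq_sqrt hs'.le,
    Fintype.sum_prod_type (f := fun i : (Fin 2 × Fin d) × Fin s => pairCoord u v i.1 ^ 2),
    sum_const, card_univ, Fintype.card_fin, nsmul_eq_mul, ← sum_div, ← mul_sum]
  field_simp

theorem rowSum_fst {d s : ℕ} {J : Type*} [Fintype J] (P : J → (Fin s ↪ Fin d)) (w : J → ℝ)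
    (r : Fin d) :
    rowSum P (fun i => w i.1) r = ∑ j, w j * if r ∈ univ.map (P j) then 1 else 0 := by
  simp only [rowSum, Fintype.sum_prod_type]
  refine sum_congr rfl fun j _ => ?_
  split_ifs with h
  · obtain ⟨l, -, hl⟩ := mem_map.1 h
    rw [sum_eq_single l]
    · simp [hl]
    · intro l' _ hne
      rw [if_neg]
      intro h'
      exact hne ((P j).injective (h'.trans hl.symm))
    · simp
  · rw [mul_zero]
    refine sum_eq_zero fun l _ => if_neg ?_
    intro h'
    exact h (mem_map.2 ⟨l, mem_univ _, h'⟩)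

/-- The number of common rows of two different columns. -/
def overlap {d s : ℕ} {J : Type*} [DecidableEq J] (P : J → (Fin s ↪ Fin d)) (j j' : J) : ℝ :=
  if j = j' then 0 else ∑ l, if P j l ∈ univ.map (P j') then 1 else 0

/-- A column paired with itself meets in all s rows, and these diagonal terms are precisely the
subtracted squares. For this reason `overlap` vanishes on the diagonal. -/
theorem sum_rowSum_sq {d s : ℕ} {J : Type*} [Fintype J] [DecidableEq J]
    (P : J → (Fin s ↪ Fin d)) (w : J → ℝ) :
    ∑ r, rowSum P (fun i => w i.1) r ^ 2 - ∑ i : J × Fin s, w i.1 ^ 2 =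
      ∑ j, ∑ j', w j * w j' * overlap P j j' := by
  have h1 : ∑ r, rowSum P (fun i => w i.1) r ^ 2 =
      ∑ j, ∑ j', w j * w j' * ∑ l, if P j l ∈ univ.map (P j') then (1 : ℝ) else 0 := by
    calc ∑ r, rowSum P (fun i => w i.1) r ^ 2
        = ∑ r, ∑ i : J × Fin s, if P i.1 i.2 = r then
            w i.1 * rowSum P (fun i => w i.1) r else 0 := by
          refine sum_congr rfl fun r _ => ?_
          rw [sq]
          nth_rewrite 1 [rowSum]
          rw [sum_mul]
          exact sum_congr rfl fun i _ => by split_ifs <;> simp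
      _ = ∑ i : J × Fin s, w i.1 * rowSum P (fun i => w i.1) (P i.1 i.2) := by
          rw [sum_comm]
          simp
      _ = _ := by
          rw [Fintype.sum_prod_type]
          refine sum_congr rfl fun j _ => ?_
          simp only [rowSum_fst, mul_sum]
          rw [sum_comm]
          refine sum_congr rfl fun j' _ => sum_congr rfl fun l _ => ?_
          ring
  have h2 : ∑ i : J × Fin s, w i.1 ^ 2 = ∑ j, ∑ j', if j = j' then (s : ℝ) * w j ^ 2 else 0 := by
    simp [Fintype.sum_prod_type]
  rw [h1, h2, ← sum_sub_distrib]
  refine sum_congr rfl fun j _ => ?_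
  rw [← sum_sub_distrib]
  refine sum_congr rfl fun j' _ => ?_
  unfold overlap
  split_ifs with h
  · subst h
    simp
    ring
  · simp

/-- Resample column `j` only: the row set of column `j'` is then a fixed set of s rows. -/
theorem sum_exp_overlap_le {d s : ℕ} {J : Type*} [Fintype J] [DecidableEq J] (hd : 0 < d)
    (j j' : J) {t : ℝ} (ht0 : 0 ≤ t) (ht1 : t ≤ 1) :
    ∑ P : J → (Fin s ↪ Fin d), Real.exp (t * overlap P j j') ≤
      Fintype.card (J → (Fin s ↪ Fin d)) * Real.exp (2 * t * (s * s / d)) := by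
  by_cases h : j = j'
  · simp only [overlap, h, if_true, mul_zero, Real.exp_zero, sum_const, card_univ, nsmul_eq_mul,
      mul_one]
    exact le_mul_of_one_le_right (by positivity) (Real.one_le_exp (by positivity))
  · have hN := card_mul_sum_eq_sum_sum_update j
      (fun P : J → (Fin s ↪ Fin d) => Real.exp (t * overlap P j j'))
    rcases (Nat.eq_zero_or_pos (Fintype.card (Fin s ↪ Fin d))) with h0 | h0
    · have : IsEmpty (J → (Fin s ↪ Fin d)) := by
        have := Fintype.card_eq_zero_iff.1 h0
        exact ⟨fun P => this.false (P j)⟩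
      simp
    · have hpos : (0 : ℝ) < Fintype.card (Fin s ↪ Fin d) := by exact_mod_cast h0
      refine le_of_mul_le_mul_left ?_ hpos
      rw [hN]
      calc _ ≤ ∑ _P : J → (Fin s ↪ Fin d),
              Fintype.card (Fin s ↪ Fin d) * Real.exp (2 * t * (s * s / d)) := by
            refine sum_le_sum fun P _ => ?_
            have := sum_embedding_exp_le (s := s) hd (univ.map (P j')) ht0 ht1
            simp only [card_map, card_univ, Fintype.card_fin] at this
            simpa only [overlap, h, if_false, Function.update_self,
              Function.update_of_ne (Ne.symm h)] using this
        _ = _ := by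
            simp only [sum_const, card_univ, nsmul_eq_mul]
            ring

theorem SparseMap.sum_exp_le {d s : ℕ} (hd : 0 < d) (hs : 0 < s) (u v : Vec d)
    (huv : ‖u‖ ^ 2 + ‖v‖ ^ 2 = 1) {t : ℝ} (ht : |t| / s ≤ 1 / 8) :
    ∑ φ : SparseMap d s, Real.exp (t * (‖φ.eval u v‖ ^ 2 - (‖u‖ ^ 2 + ‖v‖ ^ 2))) ≤
      Fintype.card (SparseMap d s) * Real.exp (8 * t ^ 2 / d) := by
  have hs' : (0 : ℝ) < s := by exact_mod_cast hs
  have hd' : (0 : ℝ) < d := by exact_mod_cast hd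
  set z := pairCoord u v with hz
  set w : Fin 2 × Fin d → ℝ := fun j => z j ^ 2 with hw
  have hw0 : ∀ j, 0 ≤ w j := fun j => sq_nonneg _
  have hw1 : ∑ j, w j = 1 := by rw [← huv, ← sum_pairCoord_sq]
  set m : ℝ := t / s with hm
  have habs : |m| ≤ 1 / 8 := by rwa [hm, abs_div, abs_of_pos hs']
  have hm2 : 4 * m ^ 2 ≤ 1 := by
    rw [← sq_abs]
    nlinarith [abs_nonneg m]
  have hsum : ∑ φ : SparseMap d s, Real.exp (t * (‖φ.eval u v‖ ^ 2 - (‖u‖ ^ 2 + ‖v‖ ^ 2))) =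
      ∑ P : Fin 2 × Fin d → (Fin s ↪ Fin d), ∑ σ : (Fin 2 × Fin d) × Fin s → ℤˣ,
        Real.exp (∑ r, m * (rowSum P (fun i => z i.1 * ((σ i : ℤ) : ℝ)) r ^ 2 -
          rowSum P (fun i => z i.1 ^ 2) r)) := by
    rw [← Fintype.sum_prod_type', ← Equiv.sum_comp (equivProd d s)]
    refine sum_congr rfl fun φ _ => ?_
    rw [norm_eval_sq hs, ← mul_sum, ← mul_sum, ← mul_assoc, hm, mul_one_div]
  have hrow : ∀ (P : Fin 2 × Fin d → (Fin s ↪ Fin d)) r, rowSum P (fun i => w i.1) r ≤ 1 := by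
    intro P r
    rw [rowSum_fst]
    refine le_trans (sum_le_sum fun j _ => ?_) hw1.le
    have := hw0 j
    split_ifs <;> simp [this]
  have hinner : ∀ P : Fin 2 × Fin d → (Fin s ↪ Fin d),
      ∑ σ : (Fin 2 × Fin d) × Fin s → ℤˣ,
        Real.exp (∑ r, m * (rowSum P (fun i => z i.1 * ((σ i : ℤ) : ℝ)) r ^ 2 -
          rowSum P (fun i => z i.1 ^ 2) r)) ≤
      Fintype.card ((Fin 2 × Fin d) × Fin s → ℤˣ) *
        ∑ j, ∑ j', w j * w j' * Real.exp (4 * m ^ 2 * overlap P j j') := by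
    intro P
    -- B = 2|m| works: a column meets a row at most once, so the squares in a row sum to at most 1,
    -- and |m| + 8m² ≤ 2|m| because |m| ≤ 1/8.
    have h := sum_exp_chaos_le (fun i : (Fin 2 × Fin d) × Fin s => P i.1 i.2) (fun i => z i.1)
      (2 * |m|) univ (fun _ => m) (by
        intro r
        have h1 := hrow P r
        have h2 : 2 * (2 * |m|) ^ 2 * rowSum P (fun i => w i.1) r ≤ 2 * (2 * |m|) ^ 2 * 1 := by
          gcongr
        change |m| + 2 * (2 * |m|) ^ 2 * rowSum P (fun i => w i.1) r ≤ 2 * |m|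
        nlinarith [abs_nonneg m])
    refine h.trans ?_
    gcongr
    have h2 := sum_rowSum_sq P w
    have h3 : ∑ i : (Fin 2 × Fin d) × Fin s, z i.1 ^ 4 =
        ∑ i : (Fin 2 × Fin d) × Fin s, w i.1 ^ 2 :=
      sum_congr rfl fun i _ => by simp only [hw]; ring
    rw [h3]
    change Real.exp ((2 * |m|) ^ 2 * (∑ r, rowSum P (fun i => w i.1) r ^ 2 - _)) ≤ _
    rw [h2, mul_pow, sq_abs]
    -- Jensen with the weights w_j w_j', which sum to 1, so that only one overlap at a time has to
    -- be averaged.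
    have hJ := (convexOn_exp).map_sum_le
      (t := (univ : Finset ((Fin 2 × Fin d) × (Fin 2 × Fin d))))
      (w := fun p => w p.1 * w p.2) (p := fun p => 4 * m ^ 2 * overlap P p.1 p.2)
      (fun p _ => mul_nonneg (hw0 _) (hw0 _))
      (by rw [Fintype.sum_prod_type]; simp [← mul_sum, hw1]) (fun _ _ => Set.mem_univ _)
    simp only [smul_eq_mul, Fintype.sum_prod_type
      (α₁ := Fin 2 × Fin d) (α₂ := Fin 2 × Fin d)] at hJ
    refine le_trans (Real.exp_le_exp.2 (le_of_eq ?_)) hJ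
    simp only [mul_sum]
    refine sum_congr rfl fun j _ => sum_congr rfl fun j' _ => ?_
    ring
  have hcard : (Fintype.card (SparseMap d s) : ℝ) =
      Fintype.card ((Fin 2 × Fin d) × Fin s → ℤˣ) *
        Fintype.card (Fin 2 × Fin d → (Fin s ↪ Fin d)) := by
    rw [Fintype.card_congr (equivProd d s), Fintype.card_prod, mul_comm]
    push_cast
    rfl
  calc _ ≤ ∑ P : Fin 2 × Fin d → (Fin s ↪ Fin d),
        Fintype.card ((Fin 2 × Fin d) × Fin s → ℤˣ) *
          ∑ j, ∑ j', w j * w j' * Real.exp (4 * m ^ 2 * overlap P j j') := by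
        rw [hsum]
        exact sum_le_sum fun P _ => hinner P
    _ = Fintype.card ((Fin 2 × Fin d) × Fin s → ℤˣ) *
          ∑ j, ∑ j', w j * w j' * ∑ P : Fin 2 × Fin d → (Fin s ↪ Fin d),
            Real.exp (4 * m ^ 2 * overlap P j j') := by
        rw [← mul_sum, sum_comm]
        congr 1
        refine sum_congr rfl fun j _ => ?_
        rw [sum_comm]
        simp only [mul_sum]
    _ ≤ Fintype.card ((Fin 2 × Fin d) × Fin s → ℤˣ) *
          ∑ j, ∑ j', w j * w j' * (Fintype.card (Fin 2 × Fin d → (Fin s ↪ Fin d)) *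
            Real.exp (2 * (4 * m ^ 2) * (s * s / d))) := by
        gcongr with j _ j' _
        exact sum_exp_overlap_le hd j j' (by positivity) hm2
    _ = _ := by
        simp only [← sum_mul, ← mul_sum, hw1, hcard, mul_one, one_mul, hm]
        rw [← mul_assoc]
        congr 2
        field_simp
        ring

/-- Tail bound for one sparse Johnson–Lindenstrauss map, in counting form. -/
theorem SparseMap.card_bad_le {d s : ℕ} {ε : ℝ} (hd : 0 < d) (hs : 0 < s) (hε : 0 < ε)
    (hsd : ε * d ≤ s) (u v : Vec d) {Z : ℝ} (hZ : Z = ‖u‖ ^ 2 + ‖v‖ ^ 2) :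
    (#{φ : SparseMap d s | ε * Z < |‖φ.eval u v‖ ^ 2 - Z|} : ℝ) ≤
      Fintype.card (SparseMap d s) * (2 * Real.exp (-(ε ^ 2 * d / 32))) := by
  have hs' : (0 : ℝ) < s := by exact_mod_cast hs
  have hd' : (0 : ℝ) < d := by exact_mod_cast hd
  -- The degenerate case Z = 0, where no normalization is possible but both vectors vanish.
  rcases (show 0 ≤ Z by rw [hZ]; positivity).eq_or_lt with h0 | h0
  · have hu : u = 0 := by
      rw [← norm_eq_zero, ← sq_eq_zero_iff]
      nlinarith [sq_nonneg ‖u‖, sq_nonneg ‖v‖]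
    have hv : v = 0 := by
      rw [← norm_eq_zero, ← sq_eq_zero_iff]
      nlinarith [sq_nonneg ‖u‖, sq_nonneg ‖v‖]
    have : ∀ φ : SparseMap d s, ¬ (ε * Z < |‖φ.eval u v‖ ^ 2 - Z|) := by
      intro φ
      have : φ.eval u v = 0 := by
        rw [hu, hv]
        simp [eval]
      rw [this, ← h0]
      simp
    rw [filter_false_of_mem fun φ _ => this φ]
    simp only [card_empty, Nat.cast_zero]
    positivity
  · set ρ := √Z with hρ
    have hρ0 : 0 < ρ := Real.sqrt_pos.2 h0
    have hρ2 : ρ ^ 2 = Z := Real.sq_sqrt h0.le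
    have hev : ∀ φ : SparseMap d s, φ.eval (ρ⁻¹ • u) (ρ⁻¹ • v) = ρ⁻¹ • φ.eval u v := by
      intro φ
      simp only [eval, WithLp.ofLp_smul, Matrix.mulVec_smul, ← smul_add, WithLp.toLp_smul]
    have hnorm : ∀ y : Vec d, ‖ρ⁻¹ • y‖ ^ 2 = ‖y‖ ^ 2 / Z := by
      intro y
      rw [norm_smul, mul_pow, norm_inv, Real.norm_eq_abs, abs_of_pos hρ0, inv_pow, hρ2]
      ring
    have hone : ‖ρ⁻¹ • u‖ ^ 2 + ‖ρ⁻¹ • v‖ ^ 2 = 1 := by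
      rw [hnorm, hnorm, ← add_div, ← hZ, div_self h0.ne']
    -- This minimizes the exponent 8b²/d - bε, with value -ε²d/32.
    set b : ℝ := ε * d / 16 with hb
    have hb0 : 0 ≤ b := by positivity
    have hbs : b / s ≤ 1 / 8 := by
      rw [div_le_div_iff₀ hs' (by norm_num)]
      linarith
    have hp := SparseMap.sum_exp_le hd hs _ _ hone (t := b) (by rwa [abs_of_nonneg hb0])
    have hn := SparseMap.sum_exp_le hd hs _ _ hone (t := -b) (by rwa [abs_neg, abs_of_nonneg hb0])
    rw [hone] at hp hn
    simp only [hev, hnorm] at hp hn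
    have hkey : (#{φ : SparseMap d s | ε * Z < |‖φ.eval u v‖ ^ 2 - Z|} : ℝ) * Real.exp (b * ε) ≤
        Fintype.card (SparseMap d s) * Real.exp (8 * b ^ 2 / d) * 2 := by
      rw [← nsmul_eq_mul, ← sum_const]
      calc _ ≤ ∑ φ ∈ {φ : SparseMap d s | ε * Z < |‖φ.eval u v‖ ^ 2 - Z|},
              (Real.exp (b * (‖φ.eval u v‖ ^ 2 / Z - 1)) +
                Real.exp (-b * (‖φ.eval u v‖ ^ 2 / Z - 1))) := by
            refine sum_le_sum fun φ hφ => ?_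
            have hφ' := (mem_filter.1 hφ).2
            rcases lt_abs.1 hφ' with h | h
            · refine le_trans (Real.exp_le_exp.2 ?_) (le_add_of_nonneg_right (Real.exp_pos _).le)
              gcongr
              rw [le_sub_iff_add_le, le_div_iff₀ h0]
              linarith
            · refine le_trans (Real.exp_le_exp.2 ?_) (le_add_of_nonneg_left (Real.exp_pos _).le)
              rw [neg_mul_comm]
              gcongr
              rw [neg_sub, le_sub_comm, div_le_iff₀ h0]
              linarith
        _ ≤ ∑ φ : SparseMap d s, (Real.exp (b * (‖φ.eval u v‖ ^ 2 / Z - 1)) +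
                Real.exp (-b * (‖φ.eval u v‖ ^ 2 / Z - 1))) :=
            sum_le_sum_of_subset_of_nonneg (filter_subset _ _) fun _ _ _ => by positivity
        _ ≤ _ := by
            rw [sum_add_distrib]
            rw [neg_sq] at hn
            linarith
    rw [← le_div_iff₀ (Real.exp_pos _)] at hkey
    refine hkey.trans (le_of_eq ?_)
    rw [mul_assoc, mul_div_assoc, mul_comm _ (2 : ℝ), mul_div_assoc, ← Real.exp_sub]
    congr 3
    rw [hb]
    field_simp
    ring

/-! ### The probability of a distortion -/

/-- A product of uniform measures is uniform on the product, so counting bounds become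
probabilities. -/
theorem pi_sparseJL_real_le {d s k : ℕ} (hsd : s ≤ d) (S : Set (Fin k → SparseMap d s)) {δ : ℝ}
    [DecidablePred (· ∈ S)]
    (hS : (#{φ | φ ∈ S} : ℝ) ≤ Fintype.card (Fin k → SparseMap d s) * δ) :
    (Measure.pi fun _ : Fin k => sparseJL d s).real S ≤ δ := by
  have := SparseMap.nonempty hsd
  have hprob : IsProbabilityMeasure (sparseJL d s) :=
    isProbabilityMeasure_uniformOn Set.finite_univ Set.univ_nonempty
  have hcard : (0 : ℝ) < Fintype.card (Fin k → SparseMap d s) := by exact_mod_cast Fintype.card_pos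
  have hsingle : ∀ a : SparseMap d s,
      (sparseJL d s).real {a} = (Fintype.card (SparseMap d s) : ℝ)⁻¹ := by
    intro a
    simp [Measure.real, sparseJL, uniformOn_univ]
  have hpoint : ∀ φ : Fin k → SparseMap d s,
      (Measure.pi fun _ : Fin k => sparseJL d s).real {φ} =
        (Fintype.card (Fin k → SparseMap d s) : ℝ)⁻¹ := by
    intro φ
    rw [Measure.real, Measure.pi_singleton, ENNReal.toReal_prod]
    change ∏ i, (sparseJL d s).real {φ i} = _
    simp [hsingle]
  have hSS : S = (({φ | φ ∈ S} : Finset (Fin k → SparseMap d s)) : Set (Fin k → SparseMap d s)) := by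
    ext φ; simp
  rw [hSS, ← sum_measureReal_singleton, sum_congr rfl fun φ _ => hpoint φ, sum_const, nsmul_eq_mul,
    ← div_eq_mul_inv, div_le_iff₀ hcard]
  linarith

/-- This is the independence of the vectors of level `i` from the map `φ i` that compresses them. -/
theorem allLevel_congr {d s k : ℕ} {φ ψ : Fin k → SparseMap d s} (v₀ : ℕ → Vec d) :
    ∀ (i : ℕ) (h : i ≤ k), (∀ i' : Fin k, i'.1 < i → φ i' = ψ i') →
      allLevel φ v₀ i h = allLevel ψ v₀ i h
  | 0, _, _ => rfl
  | i + 1, h, H => by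
      have ih := allLevel_congr v₀ i (Nat.le_of_succ_le h) fun i' hi' => H i' (by omega)
      funext j
      simp only [allLevel, ih, H ⟨i, h⟩ (Nat.lt_succ_self i)]

/-- `φ i` distorts the pair number `j` of level `i` by more than a factor `1 ± ε`. -/
def Distorts {d s k : ℕ} (ε : ℝ) (v₀ : ℕ → Vec d) (i : Fin k) (j : ℕ)
    (φ : Fin k → SparseMap d s) : Prop :=
  ε * (‖allLevel φ v₀ i i.2.le j‖ ^ 2 + ‖allLevel φ v₀ i i.2.le (j + 2 ^ i.1)‖ ^ 2) <
    |‖(φ i).eval (allLevel φ v₀ i i.2.le j) (allLevel φ v₀ i i.2.le (j + 2 ^ i.1))‖ ^ 2 -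
      (‖allLevel φ v₀ i i.2.le j‖ ^ 2 + ‖allLevel φ v₀ i i.2.le (j + 2 ^ i.1)‖ ^ 2)|

open Classical in
theorem card_distorts_le {d s k : ℕ} {ε : ℝ} (hd : 0 < d) (hs : 0 < s) (hsd : s ≤ d) (hε : 0 < ε)
    (hεs : ε * d ≤ s) (v₀ : ℕ → Vec d) (i : Fin k) (j : ℕ) :
    (#{φ : Fin k → SparseMap d s | Distorts ε v₀ i j φ} : ℝ) ≤
      Fintype.card (Fin k → SparseMap d s) * (2 * Real.exp (-(ε ^ 2 * d / 32))) := by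
  have := SparseMap.nonempty hsd
  have hpos : (0 : ℝ) < Fintype.card (SparseMap d s) := by exact_mod_cast Fintype.card_pos
  have h := card_mul_sum_eq_sum_sum_update (α := fun _ : Fin k => SparseMap d s) i
    (fun φ => if Distorts ε v₀ i j φ then (1 : ℝ) else 0)
  rw [sum_boole] at h
  refine le_of_mul_le_mul_left ?_ hpos
  rw [h]
  calc _ ≤ ∑ _φ : Fin k → SparseMap d s,
        Fintype.card (SparseMap d s) * (2 * Real.exp (-(ε ^ 2 * d / 32))) := by
        refine sum_le_sum fun φ _ => ?_
        refine le_trans (le_of_eq ?_) (SparseMap.card_bad_le hd hs hε hεs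
          (allLevel φ v₀ i i.2.le j) (allLevel φ v₀ i i.2.le (j + 2 ^ i.1)) rfl)
        rw [sum_boole]
        congr 2
        refine filter_congr fun a _ => ?_
        have hu : allLevel (Function.update φ i a) v₀ i i.2.le = allLevel φ v₀ i i.2.le :=
          allLevel_congr v₀ i i.2.le fun i' hi' => Function.update_of_ne (by
            rintro rfl
            exact lt_irrefl _ hi') _ _
        simp only [Distorts, hu, Function.update_self]
    _ = _ := by
        simp only [sum_const, card_univ, nsmul_eq_mul]
        ring

theorem one_sub_le_real_not_distorts {d s k : ℕ} {ε : ℝ} (hd : 0 < d) (hs : 0 < s) (hsd : s ≤ d)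
    (hε : 0 < ε) (hεs : ε * d ≤ s) (v₀ : ℕ → Vec d) (q : ℕ) :
    1 - k * q * (2 * Real.exp (-(ε ^ 2 * d / 32))) ≤
      (Measure.pi fun _ : Fin k => sparseJL d s).real
        {φ | ∀ i : Fin k, ∀ j < q, ¬ Distorts ε v₀ i j φ} := by
  classical
  have := SparseMap.nonempty hsd
  have hprob : IsProbabilityMeasure (sparseJL d s) :=
    isProbabilityMeasure_uniformOn Set.finite_univ Set.univ_nonempty
  -- Union bound over all k levels and q starting blocks; the word, and hence `v₀`, is fixed before
  -- the maps are drawn.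
  have h := pi_sparseJL_real_le hsd {φ : Fin k → SparseMap d s | ∃ i, ∃ j < q, Distorts ε v₀ i j φ}
    (δ := k * q * (2 * Real.exp (-(ε ^ 2 * d / 32)))) (by
      have hsub : ({φ | φ ∈ {φ : Fin k → SparseMap d s | ∃ i, ∃ j < q, Distorts ε v₀ i j φ}} :
          Finset (Fin k → SparseMap d s)) ⊆ (univ ×ˢ range q : Finset (Fin k × ℕ)).biUnion
            fun p => {φ | Distorts ε v₀ p.1 p.2 φ} := by
        intro φ hφ
        obtain ⟨i, j, hj, h⟩ := (mem_filter.1 hφ).2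
        exact mem_biUnion.2 ⟨(i, j), by simpa using hj, by simpa using h⟩
      have h1 := (card_le_card hsub).trans card_biUnion_le
      have h2 : ((#({φ | φ ∈ {φ : Fin k → SparseMap d s | ∃ i, ∃ j < q, Distorts ε v₀ i j φ}} :
          Finset (Fin k → SparseMap d s)) : ℕ) : ℝ) ≤
          ∑ p ∈ (univ ×ˢ range q : Finset (Fin k × ℕ)),
            (#{φ : Fin k → SparseMap d s | Distorts ε v₀ p.1 p.2 φ} : ℝ) := by exact_mod_cast h1
      refine h2.trans ((sum_le_sum fun p _ =>
        card_distorts_le hd hs hsd hε hεs v₀ p.1 p.2).trans (le_of_eq ?_))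
      simp only [sum_const, card_product, card_univ, Fintype.card_fin, card_range, nsmul_eq_mul]
      push_cast
      ring)
  have hc : {φ : Fin k → SparseMap d s | ∀ i : Fin k, ∀ j < q, ¬ Distorts ε v₀ i j φ} =
      {φ : Fin k → SparseMap d s | ∃ i, ∃ j < q, Distorts ε v₀ i j φ}ᶜ := by
    ext φ; simp
  rw [hc, probReal_compl_eq_one_sub (Set.toFinite _).measurableSet]
  linarith

/-! ### Norms of the levels -/

theorem norm_subword_sq {n : ℕ} (x : Vec n) (m p : ℕ) :
    ‖subword x m p‖ ^ 2 = ∑ r ∈ range m, if h : p + r < n then x ⟨p + r, h⟩ ^ 2 else 0 := by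
  rw [EuclideanSpace.norm_sq_eq,
    ← Fin.sum_univ_eq_sum_range (fun r => if h : p + r < n then x ⟨p + r, h⟩ ^ 2 else 0) m]
  refine sum_congr rfl fun r _ => ?_
  simp only [subword]
  split_ifs <;> simp

theorem norm_subword_sq_eq_sum_block {n : ℕ} (x : Vec n) (d m j : ℕ) :
    ‖subword x (d * m) (j * d)‖ ^ 2 = ∑ b ∈ range m, ‖block d x (j + b)‖ ^ 2 := by
  induction m with
  | zero => simp [norm_subword_sq]
  | succ m ih =>
    rw [sum_range_succ, ← ih, block]
    simp only [norm_subword_sq]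
    rw [Nat.mul_succ, sum_range_add]
    congr 1
    refine sum_congr rfl fun r _ => ?_
    have : j * d + (d * m + r) = (j + m) * d + r := by ring
    simp only [this]

theorem allLevel_norm_sq {d s k : ℕ} {ε : ℝ} (hε0 : 0 ≤ ε) (hε1 : ε ≤ 1) (v₀ : ℕ → Vec d) (q : ℕ)
    (φ : Fin k → SparseMap d s) (hφ : ∀ i : Fin k, ∀ j < q, ¬ Distorts ε v₀ i j φ) :
    ∀ (i : ℕ) (h : i ≤ k) (j : ℕ), j + 2 ^ i ≤ q →
      (1 - ε) ^ i * ∑ b ∈ range (2 ^ i), ‖v₀ (j + b)‖ ^ 2 ≤ ‖allLevel φ v₀ i h j‖ ^ 2 ∧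
      ‖allLevel φ v₀ i h j‖ ^ 2 ≤ (1 + ε) ^ i * ∑ b ∈ range (2 ^ i), ‖v₀ (j + b)‖ ^ 2
  | 0, _, j, _ => by simp [allLevel]
  | i + 1, h, j, hj => by
      rw [pow_succ, mul_two] at hj
      have hp := Nat.two_pow_pos i
      have ih := allLevel_norm_sq hε0 hε1 v₀ q φ hφ i (Nat.le_of_succ_le h)
      have h1 := ih j (by omega)
      have h2 := ih (j + 2 ^ i) (by omega)
      have h3 := hφ ⟨i, h⟩ j (by omega)
      simp only [Distorts, not_lt] at h3
      rw [abs_le] at h3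
      have hsum : ∑ b ∈ range (2 ^ (i + 1)), ‖v₀ (j + b)‖ ^ 2 =
          (∑ b ∈ range (2 ^ i), ‖v₀ (j + b)‖ ^ 2) +
            ∑ b ∈ range (2 ^ i), ‖v₀ (j + 2 ^ i + b)‖ ^ 2 := by
        rw [pow_succ, mul_two, sum_range_add]
        simp only [add_assoc]
      rw [hsum]
      simp only [allLevel]
      set U := ‖allLevel φ v₀ i (Nat.le_of_succ_le h) j‖ ^ 2
      set V := ‖allLevel φ v₀ i (Nat.le_of_succ_le h) (j + 2 ^ i)‖ ^ 2
      set A := ∑ b ∈ range (2 ^ i), ‖v₀ (j + b)‖ ^ 2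
      set B := ∑ b ∈ range (2 ^ i), ‖v₀ (j + 2 ^ i + b)‖ ^ 2
      constructor
      · calc (1 - ε) ^ (i + 1) * (A + B) = (1 - ε) * ((1 - ε) ^ i * A + (1 - ε) ^ i * B) := by ring
          _ ≤ (1 - ε) * (U + V) :=
            mul_le_mul_of_nonneg_left (add_le_add h1.1 h2.1) (by linarith)
          _ ≤ _ := by linarith [h3.1]
      · calc _ ≤ (1 + ε) * (U + V) := by linarith [h3.2]
          _ ≤ (1 + ε) * ((1 + ε) ^ i * A + (1 + ε) ^ i * B) :=
            mul_le_mul_of_nonneg_left (add_le_add h1.2 h2.2) (by linarith)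
          _ = _ := by ring

/-- Bernoulli gives (1-ε)^k ≥ 1 - kε ≥ (1 - kε)², and e^x ≤ 1 + 2x on [0, 1] bounds (1+ε)^k; the
latter is the source of the constant 2. -/
theorem norm_bounds_of_sq {ε a b : ℝ} {k : ℕ} (hε0 : 0 ≤ ε) (hε1 : ε ≤ 1) (hk : k * ε ≤ 1)
    (ha : 0 ≤ a) (hb : 0 ≤ b) (h1 : (1 - ε) ^ k * a ^ 2 ≤ b ^ 2)
    (h2 : b ^ 2 ≤ (1 + ε) ^ k * a ^ 2) :
    (1 - 2 * (k * ε)) * a ≤ b ∧ b ≤ (1 + 2 * (k * ε)) * a := by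
  have hke : 0 ≤ k * ε := by positivity
  have hbern : 1 - k * ε ≤ (1 - ε) ^ k := by
    have := one_add_mul_le_pow (a := -ε) (by linarith) k
    simpa [sub_eq_add_neg] using this
  have hexp : (1 + ε) ^ k ≤ 1 + 2 * (k * ε) := by
    calc (1 + ε) ^ k ≤ Real.exp ε ^ k := by
          gcongr
          linarith [Real.add_one_le_exp ε]
      _ = Real.exp (k * ε) := by rw [← Real.exp_nat_mul]
      _ ≤ 1 + 2 * (k * ε) := by
          have := Real.abs_exp_sub_one_le (x := k * ε) (by rwa [abs_of_nonneg hke])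
          rw [abs_of_nonneg hke] at this
          linarith [(abs_le.1 this).2]
  constructor
  · have h3 : (1 - k * ε) * a ≤ b := by
      refine abs_le_of_sq_le_sq' ?_ hb |>.2
      refine le_trans ?_ h1
      rw [mul_pow]
      gcongr
      nlinarith
    nlinarith
  · refine abs_le_of_sq_le_sq' ?_ (by positivity) |>.2
    refine h2.trans ?_
    rw [mul_pow]
    gcongr
    nlinarith

theorem lt_div_add_one_iff {n d m j : ℕ} (hd : 0 < d) (hdn : d ∣ n) (hm : d * m ≤ n) :
    j < (n - d * m) / d + 1 ↔ j + m ≤ n / d := by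
  obtain ⟨q, rfl⟩ := hdn
  have : m ≤ q := Nat.le_of_mul_le_mul_left hm hd
  rw [← Nat.mul_sub, Nat.mul_div_cancel_left _ hd, Nat.mul_div_cancel_left _ hd]
  omega

/-! ### The two procedures agree -/

/-- Vector `l` of level `i` for the subword that starts at block `j` covers the 2^i blocks from j +
l·2^i on. The pair 2l, 2l + 1 is therefore a pair at distance 2^i in AllSketch. The bound on `l`
keeps these blocks inside the subword. -/
theorem singleLevel_eq_allLevel {d s k : ℕ} (φ : Fin k → SparseMap d s) {v w : ℕ → Vec d} {j : ℕ}
    (hvw : ∀ l < 2 ^ k, w l = v (j + l)) :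
    ∀ (i : ℕ) (h : i ≤ k) (l : ℕ), (l + 1) * 2 ^ i ≤ 2 ^ k →
      singleLevel φ w i h l = allLevel φ v i h (j + l * 2 ^ i)
  | 0, _, l, hl => by simpa [singleLevel, allLevel] using hvw l (by omega)
  | i + 1, h, l, hl => by
      have ih := singleLevel_eq_allLevel φ hvw i (Nat.le_of_succ_le h)
      have hp := Nat.two_pow_pos i
      rw [pow_succ] at hl
      simp only [singleLevel, allLevel]
      rw [ih (2 * l) (by nlinarith), ih (2 * l + 1) (by nlinarith)]
      congr 2 <;> ring

theorem block_subword {n : ℕ} (x : Vec n) (d m j l : ℕ) (hl : l < m) :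
    block d (subword x (d * m) (j * d)) l = block d x (j + l) := by
  ext r
  have h1 : l * d + r.1 < d * m := by
    have := r.2
    nlinarith
  have h2 : j * d + (l * d + r.1) = (j + l) * d + r.1 := by ring
  simp only [block, subword, h1, dif_pos, h2]

/-- No bound on `j` is required, since both sides read 0 outside the word. -/
theorem allSketch_eq_singleSketch {n d s k : ℕ} (φ : Fin k → SparseMap d s) (x : Vec n) (j : ℕ) :
    allSketch φ x j = singleSketch φ (subword x (d * 2 ^ k) (j * d)) := by
  have := singleLevel_eq_allLevel φ (v := block d x) (j := j)
    (fun l hl => block_subword x d (2 ^ k) j l hl) k le_rfl 0 (by simp)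
  rw [singleSketch, this, allSketch]
  simp

/-! ### Linearity of SingleSketch. -/

theorem SparseMap.eval_add {d s : ℕ} (φ : SparseMap d s) (u v u' v' : Vec d) :
    φ.eval (u + u') (v + v') = φ.eval u v + φ.eval u' v' := by
  simp only [eval, WithLp.ofLp_add, Matrix.mulVec_add, ← WithLp.toLp_add]
  congr 1
  abel

theorem SparseMap.eval_smul {d s : ℕ} (φ : SparseMap d s) (a : ℝ) (u v : Vec d) :
    φ.eval (a • u) (a • v) = a • φ.eval u v := by
  simp only [eval, WithLp.ofLp_smul, Matrix.mulVec_smul, ← smul_add, WithLp.toLp_smul]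

theorem singleLevel_add {d s k : ℕ} (φ : Fin k → SparseMap d s) {u v w : ℕ → Vec d}
    (H : ∀ l, w l = u l + v l) : ∀ (i : ℕ) (h : i ≤ k) (l : ℕ),
      singleLevel φ w i h l = singleLevel φ u i h l + singleLevel φ v i h l
  | 0, _, l => H l
  | i + 1, h, l => by
      simp only [singleLevel, singleLevel_add φ H i, SparseMap.eval_add]

theorem singleLevel_smul {d s k : ℕ} (φ : Fin k → SparseMap d s) {v w : ℕ → Vec d} {a : ℝ}
    (H : ∀ l, w l = a • v l) : ∀ (i : ℕ) (h : i ≤ k) (l : ℕ),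
      singleLevel φ w i h l = a • singleLevel φ v i h l
  | 0, _, l => H l
  | i + 1, h, l => by
      simp only [singleLevel, singleLevel_smul φ H i, SparseMap.eval_smul]

theorem isLinearMap_singleSketch {d s k : ℕ} (φ : Fin k → SparseMap d s) :
    IsLinearMap ℝ (fun y : Vec (d * 2 ^ k) => singleSketch φ y) where
  map_add y z := singleLevel_add φ (fun l => by
    ext r
    simp only [block, subword, PiLp.add_apply]
    split_ifs <;> simp) k le_rfl 0
  map_smul a y := singleLevel_smul φ (fun l => by
    ext r
    simp only [block, subword, PiLp.smul_apply]
    split_ifs <;> simp) k le_rfl 0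

/-! ### The stretch of all sketches -/

theorem two_pow_le_imp_le {k n : ℕ} (h : 2 ^ k ≤ n) : k ≤ n := (Nat.lt_two_pow_self).le.trans h

theorem stretch_allSketch {n d k s : ℕ} {ε c : ℝ} (hn : 2 ≤ n) (hε0 : 0 < ε) (hε1 : ε ≤ 1)
    (hk : (k : ℝ) * ε ≤ 1) (hd : 0 < d) (hdn : d ∣ n) (hm : d * 2 ^ k ≤ n)
    (hC : 32 * (c + 3) * Real.log n / ε ^ 2 ≤ d) (hεs : ε * d ≤ s) (hsd : s ≤ d) (x : Vec n) :
    1 - (n : ℝ) ^ (-c) ≤ (Measure.pi fun _ : Fin k => sparseJL d s).real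
      {φ | ∀ j < (n - d * 2 ^ k) / d + 1,
        (1 - 2 * (k * ε)) * ‖subword x (d * 2 ^ k) (j * d)‖ ≤ ‖allSketch φ x j‖ ∧
        ‖allSketch φ x j‖ ≤ (1 + 2 * (k * ε)) * ‖subword x (d * 2 ^ k) (j * d)‖} := by
  have := SparseMap.nonempty hsd
  have hprob : IsProbabilityMeasure (sparseJL d s) :=
    isProbabilityMeasure_uniformOn Set.finite_univ Set.univ_nonempty
  have hn0 : (0 : ℝ) < n := by positivity
  have hs : 0 < s := by
    have : (0 : ℝ) < d := by exact_mod_cast hd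
    have : (0 : ℝ) < s := lt_of_lt_of_le (by positivity) hεs
    exact_mod_cast this
  have hkn : k ≤ n := two_pow_le_imp_le (le_trans (Nat.le_mul_of_pos_left _ hd) hm)
  have hqn : n / d ≤ n := Nat.div_le_self n d
  have hexp : Real.exp (-(ε ^ 2 * d / 32)) ≤ (n : ℝ) ^ (-c) / (n : ℝ) ^ 3 := by
    rw [← Real.rpow_natCast (n : ℝ) 3, ← Real.rpow_sub hn0, Real.rpow_def_of_pos hn0]
    refine Real.exp_le_exp.2 ?_
    rw [div_le_iff₀ (by positivity)] at hC
    push_cast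
    linarith
  -- The factors k, n/d and 2 are each at most n; this costs n³ and explains the 3 in 32(c + 3).
  have hfail : (k : ℝ) * (n / d : ℕ) * (2 * Real.exp (-(ε ^ 2 * d / 32))) ≤ (n : ℝ) ^ (-c) := by
    have h2 : (2 : ℝ) ≤ n := by exact_mod_cast hn
    calc _ ≤ (n : ℝ) * n * (n * ((n : ℝ) ^ (-c) / (n : ℝ) ^ 3)) := by gcongr
      _ = _ := by field_simp
  refine le_trans (sub_le_sub_left hfail 1)
    ((one_sub_le_real_not_distorts hd hs hsd hε0 hεs (block d x) (n / d)).trans ?_)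
  refine measureReal_mono ?_
  intro φ hφ j hj
  rw [lt_div_add_one_iff hd hdn hm] at hj
  have h := allLevel_norm_sq hε0.le hε1 (block d x) (n / d) φ hφ k le_rfl j hj
  rw [← norm_subword_sq_eq_sum_block] at h
  exact norm_bounds_of_sq hε0.le hε1 hk (norm_nonneg _) (norm_nonneg _) h.1 h.2

/-! ### Correctness and running time of the program -/

theorem iter_spec (f : ℕ → State → State × ℕ) (I : ℕ → State → Prop) (C : ℕ) (σ : State)
    (h0 : I 0 σ) : ∀ b : ℕ, (∀ t < b, ∀ τ, I t τ → I (t + 1) (f t τ).1 ∧ (f t τ).2 ≤ C) →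
      I b (iter f b σ).1 ∧ (iter f b σ).2 ≤ b * (C + 1)
  | 0, _ => ⟨h0, by simp [iter]⟩
  | b + 1, h => by
      obtain ⟨h1, h2⟩ := iter_spec f I C σ h0 b fun t ht => h t (by omega)
      obtain ⟨h3, h4⟩ := h b (by omega) _ h1
      refine ⟨h3, ?_⟩
      simp only [iter]
      rw [add_mul, one_mul]
      omega

/-- The rule of loops with invariant `I` and at most `C` steps per iteration. -/
theorem Cmd.exec_loop_spec (I : ℕ → State → Prop) {r : ℕ} {e : NExp} {c : Cmd} {σ : State}
    {b C : ℕ} (hb : e.eval σ = b) (h0 : I 0 σ)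
    (hstep : ∀ t < b, ∀ τ, I t τ →
      I (t + 1) (c.exec (τ.setReg r t)).1 ∧ (c.exec (τ.setReg r t)).2 ≤ C) :
    I b ((Cmd.loop r e c).exec σ).1 ∧
      ((Cmd.loop r e c).exec σ).2 ≤ b * (C + 1) + e.cost + 1 := by
  have h := iter_spec (fun t τ => c.exec (τ.setReg r t)) I C σ h0 b hstep
  simp only [Cmd.exec, hb]
  exact ⟨h.1, by omega⟩

/-- `τ` arises from `σ` by changes in the registers that satisfy `W` and in the real arrays from
number `2` on. -/
structure Frame (W : ℕ → Prop) (σ τ : State) : Prop where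
  natArr : τ.natArr = σ.natArr
  word : τ.realArr 0 = σ.realArr 0
  val : τ.realArr 1 = σ.realArr 1
  reg : ∀ r, ¬ W r → τ.reg r = σ.reg r

namespace Frame

variable {W : ℕ → Prop} {σ τ υ : State}

theorem refl (W : ℕ → Prop) (σ : State) : Frame W σ σ := ⟨rfl, rfl, rfl, fun _ _ => rfl⟩

theorem trans (h₁ : Frame W σ τ) (h₂ : Frame W τ υ) : Frame W σ υ :=
  ⟨h₂.natArr.trans h₁.natArr, h₂.word.trans h₁.word, h₂.val.trans h₁.val,
    fun r hr => (h₂.reg r hr).trans (h₁.reg r hr)⟩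

theorem mono {W' : ℕ → Prop} (h : Frame W σ τ) (hW : ∀ r, W r → W' r) : Frame W' σ τ :=
  ⟨h.natArr, h.word, h.val, fun r hr => h.reg r fun h' => hr (hW r h')⟩

theorem setReg (h : Frame W σ τ) {r v : ℕ} (hr : W r) : Frame W σ (τ.setReg r v) :=
  ⟨h.natArr, h.word, h.val, fun r' hr' => by
    rw [← h.reg r' hr']
    exact Function.update_of_ne (by rintro rfl; exact hr' hr) _ _⟩

theorem setReal (h : Frame W σ τ) {a i : ℕ} {v : ℝ} (ha : 2 ≤ a) :
    Frame W σ (τ.setReal a i v) :=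
  ⟨h.natArr, (Function.update_of_ne (by omega) _ _).trans h.word,
    (Function.update_of_ne (by omega) _ _).trans h.val, h.reg⟩

theorem isInput {n d s k : ℕ} {φ : Fin k → SparseMap d s} {x : Vec n} (h : Frame W σ τ)
    (hW : ∀ r, W r → 4 ≤ r) (hσ : IsInput φ x σ) : IsInput φ x τ where
  reg_n := (h.reg 0 fun h' => by simpa using hW _ h').trans hσ.reg_n
  reg_d := (h.reg 1 fun h' => by simpa using hW _ h').trans hσ.reg_d
  reg_k := (h.reg 2 fun h' => by simpa using hW _ h').trans hσ.reg_k
  reg_s := (h.reg 3 fun h' => by simpa using hW _ h').trans hσ.reg_s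
  word := by rw [h.word]; exact hσ.word
  pos := by rw [h.natArr]; exact hσ.pos
  val := by rw [h.val]; exact hσ.val

end Frame

@[simp] theorem State.setReg_reg (σ : State) (r v r' : ℕ) :
    (σ.setReg r v).reg r' = if r' = r then v else σ.reg r' := Function.update_apply _ _ _ _

@[simp] theorem State.setReg_realArr (σ : State) (r v : ℕ) :
    (σ.setReg r v).realArr = σ.realArr := rfl

@[simp] theorem State.setReal_reg (σ : State) (a i : ℕ) (v : ℝ) :
    (σ.setReal a i v).reg = σ.reg := rfl

@[simp] theorem State.setReal_realArr (σ : State) (a i : ℕ) (v : ℝ) (a' q : ℕ) :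
    (σ.setReal a i v).realArr a' q =
      if a' = a ∧ q = i then v else σ.realArr a' q := by
  simp only [State.setReal, Function.update_apply]
  by_cases ha : a' = a
  · subst ha; simp [Function.update_apply]
  · simp [ha]

/-- What the `l`-th nonzero entry of column `c` of `A_b` adds to cell `q` of array `2`, when vector
`j` of level `i + 1` is computed from `σ` and column `c` is multiplied with coordinate `c` of vector
`j'` of level `i`. -/
noncomputable def contribution (σ : State) (n d s i j b j' c l q : ℕ) : ℝ :=
  if q = (i + 1) * n + (j * d + σ.natArr 0 (entryCell d s i b c l)) then
    σ.realArr 1 (entryCell d s i b c l) * σ.realArr 2 (i * n + (j' * d + c)) else 0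

/-- The increment is expressed through the state `σ` before the whole map is applied, so that
increments can simply be added up. `hread` makes this legitimate: the source cell has not changed
since. -/
theorem exec_accumulate {σ τ : State} {n d s i j b j' c l : ℕ} {src : NExp}
    (hf : Frame (fun r => r = 6 ∨ r = 7) σ τ)
    (hn : σ.reg 0 = n) (hd : σ.reg 1 = d) (hs : σ.reg 3 = s) (hi : σ.reg 4 = i) (hj : σ.reg 5 = j)
    (hc : τ.reg 6 = c) (hl : τ.reg 7 = l) (hsrc : src.eval τ = j')
    (hread : τ.realArr 2 (i * n + (j' * d + c)) = σ.realArr 2 (i * n + (j' * d + c))) :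
    Frame (fun r => r = 6 ∨ r = 7) σ ((Prog.accumulate b src).exec τ).1 ∧
    ((Prog.accumulate b src).exec τ).1.reg = τ.reg ∧
    ∀ q, ((Prog.accumulate b src).exec τ).1.realArr 2 q =
      τ.realArr 2 q + contribution σ n d s i j b j' c l q := by
  rw [← hf.reg 0 (by simp)] at hn
  rw [← hf.reg 1 (by simp)] at hd
  rw [← hf.reg 3 (by simp)] at hs
  rw [← hf.reg 4 (by simp)] at hi
  rw [← hf.reg 5 (by simp)] at hj
  refine ⟨hf.setReal le_rfl, rfl, fun q => ?_⟩
  simp only [Prog.accumulate, Cmd.exec, State.setReal_realArr, Prog.cell, Prog.entry, NExp.eval,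
    RExp.eval, Prog.n, Prog.d, Prog.s, Prog.i, Prog.j, Prog.c, Prog.l, hn, hd, hs, hi, hj, hc, hl,
    hsrc, hread, true_and, contribution, ← hf.natArr, ← hf.val, entryCell]
  split_ifs with h
  · rw [h]
  · rw [add_zero]

/-- What column `c` of the map adds to cell `q`. -/
noncomputable def entrySum (σ : State) (n d s i j pw c l q : ℕ) : ℝ :=
  contribution σ n d s i j 0 j c l q + contribution σ n d s i j 1 (j + pw) c l q

/-- Nothing is written below the start of the target vector. Hence the sources in level `i` and the
finished vectors of level `i + 1` survive. -/
theorem contribution_eq_zero {σ : State} {n d s i j b j' c l q : ℕ}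
    (h : q < (i + 1) * n + j * d) :
    contribution σ n d s i j b j' c l q = 0 :=
  if_neg (by omega)

theorem entrySum_eq_zero {σ : State} {n d s i j pw c l q : ℕ} (h : q < (i + 1) * n + j * d) :
    entrySum σ n d s i j pw c l q = 0 := by
  rw [entrySum, contribution_eq_zero h, contribution_eq_zero h, add_zero]

theorem exec_applyMap {σ : State} {n d s i j pw : ℕ}
    (hn : σ.reg 0 = n) (hd : σ.reg 1 = d) (hs : σ.reg 3 = s) (hi : σ.reg 4 = i) (hj : σ.reg 5 = j)
    (hpw : σ.reg 8 = pw) (hjn : (j + pw + 1) * d ≤ n) :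
    (Frame (fun r => r = 6 ∨ r = 7) σ (Prog.applyMap.exec σ).1 ∧
      ∀ q, (Prog.applyMap.exec σ).1.realArr 2 q =
        (if (i + 1) * n + j * d ≤ q ∧ q < (i + 1) * n + j * d + d then 0 else σ.realArr 2 q) +
          ∑ c ∈ range d, ∑ l ∈ range s, entrySum σ n d s i j pw c l q) ∧
    (Prog.applyMap.exec σ).2 ≤ 160 * (d * s) + 20 * d + 4 := by
  set Z : ℕ → ℝ := fun q =>
    if (i + 1) * n + j * d ≤ q ∧ q < (i + 1) * n + j * d + d then 0 else σ.realArr 2 q with hZ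
  -- Both source vectors lie in the first n cells of level `i`, by `hjn`, hence below every cell
  -- written here.
  have hread : ∀ j' c, j' ≤ j + pw → c < d → i * n + (j' * d + c) < (i + 1) * n := by
    intro j' c hj' hc
    nlinarith
  have h1 := Cmd.exec_loop_spec (r := 6) (e := Prog.d)
    (c := .setReal 2 (Prog.cell (.add Prog.i (.const 1)) Prog.j Prog.c) .zero) (σ := σ)
    (b := d) (C := 14)
    (fun t τ => Frame (fun r => r = 6 ∨ r = 7) σ τ ∧ ∀ q, τ.realArr 2 q =
      if (i + 1) * n + j * d ≤ q ∧ q < (i + 1) * n + j * d + t then 0 else σ.realArr 2 q)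
    hd ⟨Frame.refl _ _, fun q => by rw [if_neg (by omega)]⟩ (by
      rintro t ht τ ⟨hf, hτ⟩
      refine ⟨⟨(hf.setReg (Or.inl rfl)).setReal le_rfl, fun q => ?_⟩, Nat.le_of_ble_eq_true rfl⟩
      rw [← hf.reg 0 (by simp)] at hn
      rw [← hf.reg 1 (by simp)] at hd
      rw [← hf.reg 4 (by simp)] at hi
      rw [← hf.reg 5 (by simp)] at hj
      simp [Cmd.exec, Prog.cell, NExp.eval, RExp.eval, Prog.n, Prog.d, Prog.i, Prog.j, Prog.c,
        hn, hd, hi, hj, hτ]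
      split_ifs <;> first | rfl | omega)
  set σ₁ := ((Cmd.loop 6 Prog.d
    (.setReal 2 (Prog.cell (.add Prog.i (.const 1)) Prog.j Prog.c) .zero)).exec σ).1 with hσ₁
  have h2 := Cmd.exec_loop_spec (r := 6) (e := Prog.d)
    (c := .loop 7 Prog.s (.seq (Prog.accumulate 0 Prog.j)
      (Prog.accumulate 1 (.add Prog.j Prog.pw)))) (σ := σ₁) (b := d) (C := s * 155 + 2)
    (fun t τ => Frame (fun r => r = 6 ∨ r = 7) σ τ ∧ ∀ q, τ.realArr 2 q =
      Z q + ∑ c ∈ range t, ∑ l ∈ range s, entrySum σ n d s i j pw c l q)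
    ((h1.1.1.reg 1 (by simp)).trans hd)
    ⟨h1.1.1, fun q => by rw [h1.1.2, range_zero, sum_empty, add_zero]⟩ (by
      rintro t ht τ ⟨hf, hτ⟩
      have h3 := Cmd.exec_loop_spec (r := 7) (e := Prog.s)
        (c := .seq (Prog.accumulate 0 Prog.j) (Prog.accumulate 1 (.add Prog.j Prog.pw)))
        (σ := τ.setReg 6 t) (b := s) (C := 154)
        (fun m υ => Frame (fun r => r = 6 ∨ r = 7) σ υ ∧ υ.reg 6 = t ∧ ∀ q, υ.realArr 2 q =
          Z q + ∑ c ∈ range t, ∑ l ∈ range s, entrySum σ n d s i j pw c l q +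
            ∑ l ∈ range m, entrySum σ n d s i j pw t l q)
        (by rw [← hs]; exact hf.reg 3 (by simp))
        ⟨hf.setReg (Or.inl rfl), by simp, fun q => by simp [hτ]⟩ (by
          rintro m hm υ ⟨hg, hg6, hυ⟩
          have hold : ∀ q < (i + 1) * n, υ.realArr 2 q = σ.realArr 2 q := by
            intro q hq
            rw [hυ]
            simp only [entrySum_eq_zero (Nat.lt_add_right _ hq), sum_const_zero, add_zero, hZ]
            rw [if_neg (by omega)]
          obtain ⟨ha, har, haq⟩ := exec_accumulate (b := 0) (src := Prog.j) (j' := j) (c := t)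
            (l := m) (hg.setReg (r := 7) (v := m) (Or.inr rfl)) hn hd hs hi hj (by simp [hg6])
            (by simp) (by simp [Prog.j, NExp.eval, hg.reg 5 (by simp), hj])
            (hold _ (hread _ _ (by omega) ht))
          obtain ⟨hb, hbr, hbq⟩ := exec_accumulate (b := 1) (src := .add Prog.j Prog.pw)
            (j' := j + pw) (c := t) (l := m) ha hn hd hs hi hj (by rw [har]; simp [hg6])
            (by rw [har]; simp)
            (by
              change ((Prog.accumulate 0 Prog.j).exec (υ.setReg 7 m)).1.reg 5 +
                ((Prog.accumulate 0 Prog.j).exec (υ.setReg 7 m)).1.reg 8 = _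
              rw [har]
              simp [hg.reg 5 (by simp), hg.reg 8 (by simp), hj, hpw])
            (by
              have hq := hread (j + pw) t le_rfl ht
              rw [haq, contribution_eq_zero (Nat.lt_add_right _ hq), add_zero]
              exact hold _ hq)
          refine ⟨⟨hb, by simp only [Cmd.exec]; rw [hbr, har]; simp [hg6], fun q => ?_⟩,
            Nat.le_of_ble_eq_true rfl⟩
          simp only [Cmd.exec]
          rw [hbq, haq, State.setReg_realArr, hυ, sum_range_succ, entrySum]
          ring)
      refine ⟨⟨h3.1.1, fun q => ?_⟩, h3.2⟩
      rw [h3.1.2.2, sum_range_succ]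
      ring)
  refine ⟨h2.1, ?_⟩
  have hc1 := h1.2
  have hc2 := h2.2
  have : Prog.d.cost = 1 := rfl
  rw [this] at hc1 hc2
  change _ + _ ≤ _
  nlinarith

/-- Array `2` of `σ` holds vector `j` of level `i`. -/
def HoldsVec {n d s k : ℕ} (φ : Fin k → SparseMap d s) (x : Vec n) (i : ℕ) (h : i ≤ k) (j : ℕ)
    (σ : State) : Prop :=
  ∀ r : Fin d, σ.realArr 2 (i * n + (j * d + r)) = allLevel φ (block d x) i h j r

theorem sum_contribution {n d s k : ℕ} {φ : Fin k → SparseMap d s} {x : Vec n} {σ : State}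
    (hσ : IsInput φ x σ) (i : Fin k) (b : Fin 2) (j j' : ℕ) {u : Vec d}
    (hu : ∀ r : Fin d, σ.realArr 2 (i * n + (j' * d + r)) = u r) (r : Fin d) :
    ∑ c ∈ range d, ∑ l ∈ range s,
      contribution σ n d s i j b j' c l ((i + 1) * n + (j * d + r)) =
        ((φ i).mat b).mulVec u.ofLp r := by
  rw [← Fin.sum_univ_eq_sum_range (fun c => ∑ l ∈ range s,
    contribution σ n d s i j b j' c l ((i + 1) * n + (j * d + r)))]
  simp only [Matrix.mulVec, dotProduct, SparseMap.mat, Matrix.of_apply, sum_mul]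
  refine sum_congr rfl fun c _ => ?_
  rw [← Fin.sum_univ_eq_sum_range
    (fun l => contribution σ n d s i j b j' c l ((i + 1) * n + (j * d + r)))]
  refine sum_congr rfl fun l _ => ?_
  simp only [contribution, hσ.pos, hσ.val, hu, add_right_inj, ← Fin.ext_iff, ite_mul, zero_mul,
    eq_comm]

theorem sum_entrySum {n d s k : ℕ} {φ : Fin k → SparseMap d s} {x : Vec n} {σ : State}
    (hσ : IsInput φ x σ) {i : ℕ} (h : i + 1 ≤ k) {j : ℕ}
    (h1 : HoldsVec φ x i (Nat.le_of_succ_le h) j σ)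
    (h2 : HoldsVec φ x i (Nat.le_of_succ_le h) (j + 2 ^ i) σ) (r : Fin d) :
    ∑ c ∈ range d, ∑ l ∈ range s, entrySum σ n d s i j (2 ^ i) c l
      ((i + 1) * n + (j * d + r)) = allLevel φ (block d x) (i + 1) h j r := by
  simp only [entrySum, sum_add_distrib]
  have e1 := sum_contribution hσ ⟨i, h⟩ 0 j j h1 r
  have e2 := sum_contribution hσ ⟨i, h⟩ 1 j (j + 2 ^ i) h2 r
  exact congrArg₂ (· + ·) e1 e2

theorem exec_level {n d s k : ℕ} {φ : Fin k → SparseMap d s} {x : Vec n} {σ : State}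
    (hσ : IsInput φ x σ) {i : ℕ} (h : i + 1 ≤ k) (hi : σ.reg 4 = i) (hpw : σ.reg 8 = 2 ^ i)
    (hlev : ∀ j, j + 2 ^ i ≤ n / d → HoldsVec φ x i (Nat.le_of_succ_le h) j σ) :
    (Frame (fun r => r = 5 ∨ r = 6 ∨ r = 7) σ
        ((Cmd.loop 5 (Prog.count (.add Prog.pw Prog.pw)) Prog.applyMap).exec σ).1 ∧
      ∀ j, j + 2 ^ (i + 1) ≤ n / d → HoldsVec φ x (i + 1) h j
        ((Cmd.loop 5 (Prog.count (.add Prog.pw Prog.pw)) Prog.applyMap).exec σ).1) ∧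
    ((Cmd.loop 5 (Prog.count (.add Prog.pw Prog.pw)) Prog.applyMap).exec σ).2 ≤
      (n / d) * (160 * (d * s) + 20 * d + 5) + 10 := by
  have hp := Nat.two_pow_pos i
  have h2 : 2 ^ (i + 1) = 2 ^ i + 2 ^ i := by rw [pow_succ, mul_two]
  have hb : (Prog.count (.add Prog.pw Prog.pw)).eval σ = n / d + 1 - 2 ^ (i + 1) := by
    simp [Prog.count, NExp.eval, Prog.pw, Prog.n, Prog.d, hσ.reg_n, hσ.reg_d, hpw, h2]
  have hloop := Cmd.exec_loop_spec (r := 5) (c := Prog.applyMap) (σ := σ)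
    (C := 160 * (d * s) + 20 * d + 4)
    -- The middle clause protects level `i` as a source; the last one collects the finished vectors
    -- of the new level.
    (fun t τ => Frame (fun r => r = 5 ∨ r = 6 ∨ r = 7) σ τ ∧
      (∀ q < (i + 1) * n, τ.realArr 2 q = σ.realArr 2 q) ∧
      ∀ j < t, HoldsVec φ x (i + 1) h j τ) hb
    ⟨Frame.refl _ _, fun _ _ => rfl, fun j hj => absurd hj (Nat.not_lt_zero j)⟩ (by
      rintro t ht τ ⟨hf, hold, hτ⟩
      have hin : IsInput φ x (τ.setReg 5 t) :=
        (hf.setReg (Or.inl rfl)).isInput (by omega) hσ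
      have htd : t + 2 ^ i + 2 ^ i ≤ n / d := by omega
      have hdn : (n / d) * d ≤ n := Nat.div_mul_le_self n d
      have hjn : (t + 2 ^ i + 1) * d ≤ n := (Nat.mul_le_mul_right d (by omega)).trans hdn
      have hread : ∀ j ≤ t + 2 ^ i, HoldsVec φ x i (Nat.le_of_succ_le h) j (τ.setReg 5 t) := by
        intro j hj r
        rw [State.setReg_realArr, hold, hlev j (by omega)]
        have := r.2
        nlinarith
      have ha := exec_applyMap (σ := τ.setReg 5 t) (i := i) (j := t) (pw := 2 ^ i)
        hin.reg_n hin.reg_d hin.reg_s (by simp [hf.reg 4 (by simp), hi]) (by simp)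
        (by simp [hf.reg 8 (by simp), hpw]) hjn
      have hkeep : ∀ q < (i + 1) * n + t * d,
          (Prog.applyMap.exec (τ.setReg 5 t)).1.realArr 2 q = τ.realArr 2 q := by
        intro q hq
        rw [ha.1.2, if_neg (by omega)]
        simp only [entrySum_eq_zero hq, sum_const_zero, add_zero, State.setReg_realArr]
      refine ⟨⟨(hf.setReg (Or.inl rfl)).trans (ha.1.1.mono (by omega)), fun q hq => ?_,
        fun j hj r => ?_⟩, ha.2⟩
      · rw [hkeep q (by omega), hold q hq]
      · rcases (Nat.lt_succ_iff_lt_or_eq.1 hj) with hj | rfl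
        · rw [hkeep _ (by have := r.2; nlinarith), hτ j hj]
        · rw [ha.1.2, if_pos (by have := r.2; omega), zero_add,
            sum_entrySum hin h (hread _ (by omega)) (hread _ le_rfl)])
  refine ⟨⟨hloop.1.1, fun j hj => hloop.1.2.2 j (by omega)⟩, hloop.2.trans ?_⟩
  have hcost : (Prog.count (.add Prog.pw Prog.pw)).cost = 9 := rfl
  rw [hcost]
  have : n / d + 1 - 2 ^ (i + 1) ≤ n / d :=
    Nat.sub_le_of_le_add (Nat.add_le_add_left (Nat.two_pow_pos _) _)
  nlinarith [Nat.mul_le_mul_right (160 * (d * s) + 20 * d + 4 + 1) this]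

theorem exec_levels {n d s k : ℕ} {φ : Fin k → SparseMap d s} {x : Vec n} {σ : State}
    (hσ : IsInput φ x σ) (hpw : σ.reg 8 = 1)
    (hlev : ∀ j, j + 1 ≤ n / d → HoldsVec φ x 0 (Nat.zero_le k) j σ) {c : Cmd}
    (hc : c = .loop 4 Prog.k (.seq (.loop 5 (Prog.count (.add Prog.pw Prog.pw)) Prog.applyMap)
      (.setReg 8 (.add Prog.pw Prog.pw)))) :
    (Frame (4 ≤ ·) σ (c.exec σ).1 ∧ (c.exec σ).1.reg 8 = 2 ^ k ∧
      ∀ j, j + 2 ^ k ≤ n / d → HoldsVec φ x k le_rfl j (c.exec σ).1) ∧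
    (c.exec σ).2 ≤ k * ((n / d) * (160 * (d * s) + 20 * d + 5) + 15) + 2 := by
  subst hc
  have hloop := Cmd.exec_loop_spec (r := 4) (e := Prog.k)
    (c := .seq (.loop 5 (Prog.count (.add Prog.pw Prog.pw)) Prog.applyMap)
      (.setReg 8 (.add Prog.pw Prog.pw))) (σ := σ)
    (C := (n / d) * (160 * (d * s) + 20 * d + 5) + 14)
    -- The bound t ≤ k is quantified inside because `HoldsVec` carries it as a proof, while an
    -- invariant must make sense for every t.
    (fun t τ => Frame (4 ≤ ·) σ τ ∧ τ.reg 8 = 2 ^ t ∧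
      ∀ (h : t ≤ k) (j : ℕ), j + 2 ^ t ≤ n / d → HoldsVec φ x t h j τ) hσ.reg_k
    ⟨Frame.refl _ _, hpw, fun _ => hlev⟩ (by
      rintro t ht τ ⟨hf, h8, hτ⟩
      have hf' : Frame (4 ≤ ·) σ (τ.setReg 4 t) := hf.setReg le_rfl
      have hl := exec_level (hf'.isInput (fun _ h => h) hσ) ht (by simp) (by simp [h8])
        (hτ ht.le)
      refine ⟨⟨(hf'.trans (hl.1.1.mono (by omega))).setReg (by norm_num), ?_,
        fun h j hj => hl.1.2 j hj⟩, ?_⟩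
      · have h8' := hl.1.1.reg 8 (by simp)
        simp only [State.setReg_reg, h8] at h8'
        simp only [Cmd.exec, NExp.eval, Prog.pw, State.setReg_reg, if_true]
        simp only [Cmd.exec, Prog.pw] at h8'
        rw [h8', pow_succ, mul_two]
        simp
      · have := hl.2
        simp only [Cmd.exec] at this ⊢
        have hcost : (NExp.add Prog.pw Prog.pw).cost = 3 := rfl
        omega)
  exact ⟨⟨hloop.1.1, hloop.1.2.1, hloop.1.2.2 le_rfl⟩, hloop.2⟩

theorem exec_copyInput {n d s k : ℕ} {φ : Fin k → SparseMap d s} {x : Vec n} {σ : State}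
    (hσ : IsInput φ x σ) {c : Cmd}
    (hc : c = .loop 6 Prog.n (.setReal 2 Prog.c (.get 0 Prog.c))) :
    (Frame (4 ≤ ·) σ (c.exec σ).1 ∧
      ∀ j, j + 1 ≤ n / d → HoldsVec φ x 0 (Nat.zero_le k) j (c.exec σ).1) ∧
    (c.exec σ).2 ≤ n * 5 + 2 := by
  subst hc
  have hloop := Cmd.exec_loop_spec (r := 6) (e := Prog.n)
    (c := .setReal 2 Prog.c (.get 0 Prog.c)) (σ := σ) (C := 4)
    (fun t τ => Frame (4 ≤ ·) σ τ ∧ ∀ q < t, τ.realArr 2 q = σ.realArr 0 q) hσ.reg_n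
    ⟨Frame.refl _ _, fun q hq => absurd hq (Nat.not_lt_zero q)⟩ (by
      rintro t ht τ ⟨hf, hτ⟩
      refine ⟨⟨(hf.setReg (by norm_num)).setReal le_rfl, fun q hq => ?_⟩,
        Nat.le_of_ble_eq_true rfl⟩
      simp only [Cmd.exec, State.setReal_realArr, NExp.eval, RExp.eval, Prog.c, State.setReg_reg,
        if_true, true_and, State.setReg_realArr, hf.word]
      split_ifs with h
      · rw [h]
      · exact hτ q (by omega))
  refine ⟨⟨hloop.1.1, fun j hj r => ?_⟩, hloop.2⟩
  have hdn : (n / d) * d ≤ n := Nat.div_mul_le_self n d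
  have hlt : j * d + r.1 < n := by
    have := r.2
    nlinarith
  rw [zero_mul, zero_add, hloop.1.2 _ hlt, hσ.word ⟨_, hlt⟩]
  simp [allLevel, block, subword, hlt]

theorem exec_copyOutput {n d s k : ℕ} {φ : Fin k → SparseMap d s} {x : Vec n} {σ : State}
    (hσ : IsInput φ x σ) (hpw : σ.reg 8 = 2 ^ k)
    (hlev : ∀ j, j + 2 ^ k ≤ n / d → HoldsVec φ x k le_rfl j σ) {c : Cmd}
    (hc : c = .loop 5 (Prog.count Prog.pw) (.loop 6 Prog.d
      (.setReal 3 (.add (.mul Prog.j Prog.d) Prog.c)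
        (.get 2 (Prog.cell Prog.k Prog.j Prog.c))))) :
    (∀ j, j + 2 ^ k ≤ n / d → ∀ r : Fin d,
      (c.exec σ).1.realArr 3 (j * d + r) = allSketch φ x j r) ∧
    (c.exec σ).2 ≤ (n / d) * (d * 30 + 3) + 8 := by
  subst hc
  have hp := Nat.two_pow_pos k
  have hb : (Prog.count Prog.pw).eval σ = n / d + 1 - 2 ^ k := by
    simp [Prog.count, NExp.eval, Prog.pw, Prog.n, Prog.d, hσ.reg_n, hσ.reg_d, hpw]
  have hloop := Cmd.exec_loop_spec (r := 5)
    (c := .loop 6 Prog.d (.setReal 3 (.add (.mul Prog.j Prog.d) Prog.c)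
        (.get 2 (Prog.cell Prog.k Prog.j Prog.c)))) (σ := σ) (C := d * 30 + 2)
    (fun t τ => Frame (4 ≤ ·) σ τ ∧ (∀ q, τ.realArr 2 q = σ.realArr 2 q) ∧
      ∀ q < t * d, τ.realArr 3 q = σ.realArr 2 (k * n + q)) hb
    ⟨Frame.refl _ _, fun _ => rfl, fun q hq => by omega⟩ (by
      rintro t ht τ ⟨hf, h2, h3⟩
      have hin := hf.isInput (fun _ h => h) hσ
      have hinner := Cmd.exec_loop_spec (r := 6) (e := Prog.d)
        (c := .setReal 3 (.add (.mul Prog.j Prog.d) Prog.c)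
          (.get 2 (Prog.cell Prog.k Prog.j Prog.c))) (σ := τ.setReg 5 t) (C := 29)
        (fun m υ => Frame (4 ≤ ·) σ υ ∧ υ.reg 5 = t ∧ (∀ q, υ.realArr 2 q = σ.realArr 2 q) ∧
          ∀ q < t * d + m, υ.realArr 3 q = σ.realArr 2 (k * n + q)) hin.reg_d
        ⟨hf.setReg (by norm_num), by simp, h2, h3⟩ (by
          rintro m hm υ ⟨hg, h5, hg2, hg3⟩
          have hin' := hg.isInput (fun _ h => h) hσ
          refine ⟨⟨(hg.setReg (by norm_num)).setReal (by norm_num), by simpa [Cmd.exec] using h5,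
            fun q => ?_, fun q hq => ?_⟩, Nat.le_of_ble_eq_true rfl⟩
          · simpa [Cmd.exec] using hg2 q
          · simp [Cmd.exec, NExp.eval, RExp.eval, Prog.cell, Prog.k, Prog.j, Prog.c, Prog.d,
              Prog.n, h5, hin'.reg_d, hin'.reg_n, hin'.reg_k, hg2]
            split_ifs with h
            · rw [h]
            · exact hg3 q (by omega))
      refine ⟨⟨hinner.1.1, hinner.1.2.2.1, fun q hq => hinner.1.2.2.2 q (by linarith)⟩, hinner.2⟩)
  refine ⟨fun j hj r => ?_, hloop.2.trans ?_⟩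
  · rw [hloop.1.2.2, hlev j hj, allSketch]
    have hr := r.2
    have : j + 1 ≤ n / d + 1 - 2 ^ k := by omega
    nlinarith
  · have hcost : (Prog.count Prog.pw).cost = 7 := rfl
    rw [hcost]
    have : n / d + 1 - 2 ^ k ≤ n / d :=
      Nat.sub_le_of_le_add (Nat.add_le_add_left (Nat.two_pow_pos _) _)
    nlinarith [Nat.mul_le_mul_right (d * 30 + 2 + 1) this]

theorem exec_allSketch {n d s k : ℕ} {φ : Fin k → SparseMap d s} {x : Vec n} {σ : State}
    (hσ : IsInput φ x σ) (hn : 0 < n) (hs : 0 < s) :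
    (∀ j, j + 2 ^ k ≤ n / d → ∀ r : Fin d,
      (Prog.allSketch.exec σ).1.realArr 3 (j * d + r) = allSketch φ x j r) ∧
    (Prog.allSketch.exec σ).2 ≤ 300 * ((k + 1) * (n * s)) := by
  obtain ⟨⟨f1, l1⟩, t1⟩ := exec_copyInput hσ rfl
  set σ₁ := ((Cmd.loop 6 Prog.n (.setReal 2 Prog.c (.get 0 Prog.c))).exec σ).1
  have f2 : Frame (4 ≤ ·) σ (σ₁.setReg 8 1) := f1.setReg (by norm_num)
  obtain ⟨⟨f3, p3, l3⟩, t3⟩ := exec_levels (f2.isInput (fun _ h => h) hσ) (by simp) l1 rfl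
  obtain ⟨o4, t4⟩ := exec_copyOutput ((f2.trans f3).isInput (fun _ h => h) hσ) p3 l3 rfl
  refine ⟨o4, ?_⟩
  -- The summand 2 is the cost of initializing register 8.
  have htime := add_le_add t1 (add_le_add (le_refl 2) (add_le_add t3 t4))
  refine le_trans htime ?_
  set q := n / d
  have hq : q * d ≤ n := Nat.div_mul_le_self n d
  have hqn : q ≤ n := Nat.div_le_self n d
  have h1 : n ≤ n * s := Nat.le_mul_of_pos_right n hs
  have h2 : q * d * s ≤ n * s := Nat.mul_le_mul_right s hq
  have h3 : q * (160 * (d * s) + 20 * d + 5) + 15 ≤ 200 * (n * s) := by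
    have : q * (160 * (d * s) + 20 * d + 5) = 160 * (q * d * s) + 20 * (q * d) + 5 * q := by ring
    omega
  have h4 := Nat.mul_le_mul_left k h3
  have h5 : q * (d * 30 + 3) = 30 * (q * d) + 3 * q := by ring
  have h6 : 300 * ((k + 1) * (n * s)) = k * (200 * (n * s)) + k * (100 * (n * s)) +
    300 * (n * s) := by ring
  rw [h5, h6]
  have : 0 ≤ k * (100 * (n * s)) := Nat.zero_le _
  omega

/-! ### The step count in terms of n and ε. -/

theorem time_bound {n d k s : ℕ} {ε C : ℝ} (hn : 2 ≤ n) (hε0 : 0 < ε) (hd : 0 < d)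
    (hm : d * 2 ^ k ≤ n) (hdC : (d : ℝ) ≤ C * Real.log n / ε ^ 2) (hsC : (s : ℝ) ≤ C * (ε * d)) :
    ((300 * ((k + 1) * (n * s)) : ℕ) : ℝ) ≤ 900 * (C ^ 2 + 1) * (n * Real.log n ^ 2 / ε) := by
  have hn2 : (2 : ℝ) ≤ n := by exact_mod_cast hn
  have hlog : Real.log 2 ≤ Real.log n := Real.log_le_log (by norm_num) hn2
  have hl2 := Real.log_two_gt_d9
  have hL : 0 < Real.log n := by linarith
  have hd' : (0 : ℝ) < d := by exact_mod_cast hd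
  have hC : 0 < C := by
    by_contra hC
    have : C * Real.log n / ε ^ 2 ≤ 0 :=
      div_nonpos_of_nonpos_of_nonneg (mul_nonpos_of_nonpos_of_nonneg (not_lt.1 hC) hL.le)
        (by positivity)
    linarith
  have hs : (s : ℝ) ≤ C ^ 2 * Real.log n / ε := by
    calc (s : ℝ) ≤ C * (ε * d) := hsC
      _ ≤ C * (ε * (C * Real.log n / ε ^ 2)) := by gcongr
      _ = _ := by field_simp
  -- From 2^k ≤ n and 2 ≤ n it follows that k + 1 ≤ 2 log n / log 2, and log 2 > 2/3.
  have hk : ((k : ℝ) + 1) ≤ 3 * Real.log n := by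
    have h1 : (2 : ℝ) ^ k ≤ n := by
      exact_mod_cast (Nat.le_mul_of_pos_left _ hd).trans hm
    have h2 : k * Real.log 2 ≤ Real.log n := by
      rw [← Real.log_pow]
      exact Real.log_le_log (by positivity) h1
    have h3 : (0 : ℝ) ≤ k := Nat.cast_nonneg k
    nlinarith
  push_cast
  calc 300 * (((k : ℝ) + 1) * (n * s))
      ≤ 300 * ((3 * Real.log n) * (n * (C ^ 2 * Real.log n / ε))) := by gcongr
    _ = 900 * C ^ 2 * (n * Real.log n ^ 2 / ε) := by ring
    _ ≤ _ := by
      gcongr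
      linarith

end Sketch

theorem mainTheorem5 :
    ∃ K : ℝ, 0 < K ∧ ∀ c : ℝ, 0 < c → ∃ C₀ : ℝ, 0 < C₀ ∧ ∀ C₁ : ℝ, ∃ T : ℝ, 0 < T ∧
      ∀ (n d k s : ℕ) (ε : ℝ), 2 ≤ n → 0 < ε → ε ≤ 1 → (k : ℝ) * ε ≤ 1 →
        d ∣ n → d * 2 ^ k ≤ n →
        C₀ * Real.log n / ε ^ 2 ≤ (d : ℝ) → (d : ℝ) ≤ C₁ * Real.log n / ε ^ 2 →
        ε * d ≤ (s : ℝ) → (s : ℝ) ≤ C₁ * (ε * d) → s ≤ d →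
        ∀ x : Sketch.Vec n,
          -- the stretch, for all subwords simultaneously, with high probability
          (1 - (n : ℝ) ^ (-c) ≤
            (MeasureTheory.Measure.pi fun _ : Fin k => Sketch.sparseJL d s).real
              {φ | ∀ j < (n - d * 2 ^ k) / d + 1,
                (1 - K * (k * ε)) * ‖Sketch.subword x (d * 2 ^ k) (j * d)‖
                    ≤ ‖Sketch.allSketch φ x j‖ ∧
                ‖Sketch.allSketch φ x j‖
                    ≤ (1 + K * (k * ε)) * ‖Sketch.subword x (d * 2 ^ k) (j * d)‖}) ∧
          ∀ φ : Fin k → Sketch.SparseMap d s,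
            -- the sketches are given by the map of the procedure for one word, which is linear
            IsLinearMap ℝ (fun y : Sketch.Vec (d * 2 ^ k) => Sketch.singleSketch φ y) ∧
            (∀ j < (n - d * 2 ^ k) / d + 1,
              Sketch.allSketch φ x j =
                Sketch.singleSketch φ (Sketch.subword x (d * 2 ^ k) (j * d))) ∧
            -- the program computes all the sketches within the time bound
            ∀ σ : Sketch.State, Sketch.IsInput φ x σ →
              (∀ j < (n - d * 2 ^ k) / d + 1, ∀ r : Fin d,
                (Sketch.Prog.allSketch.exec σ).1.realArr 3 (j * d + r) =
                  Sketch.allSketch φ x j r) ∧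
              ((Sketch.Prog.allSketch.exec σ).2 : ℝ) ≤ T * (n * Real.log n ^ 2 / ε) := by
  -- The + 1 in T makes it positive for every real `C₁`, including 0.
  refine ⟨2, by norm_num, fun c hc => ⟨32 * (c + 3), by positivity, fun C₁ =>
    ⟨900 * (C₁ ^ 2 + 1), by positivity, ?_⟩⟩⟩
  intro n d k s ε hn hε0 hε1 hk hdn hm hC0 hC1 hεs hsC hsd x
  have hd : 0 < d := Nat.pos_of_dvd_of_pos hdn (by omega)
  have hs : 0 < s := by
    have hd' : (0 : ℝ) < d := by exact_mod_cast hd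
    exact_mod_cast lt_of_lt_of_le (mul_pos hε0 hd') hεs
  refine ⟨Sketch.stretch_allSketch hn hε0 hε1 hk hd hdn hm hC0 hεs hsd x, fun φ =>
    ⟨Sketch.isLinearMap_singleSketch φ, fun j _ => Sketch.allSketch_eq_singleSketch φ x j,
      fun σ hσ => ?_⟩⟩
  obtain ⟨hout, htime⟩ := Sketch.exec_allSketch hσ (by omega) hs
  refine ⟨fun j hj r => hout j ((Sketch.lt_div_add_one_iff hd hdn hm).1 hj) r, ?_⟩
  exact le_trans (by exact_mod_cast htime) (Sketch.time_bound hn hε0 hd hm hC1 hsC)
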